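/- Fix $0<\gamma<1$ and $T\in(0,\infty]$. For a locally integrable function $\varphi$ on $[0,T)$ with values in a finite-dimensional real space, write $\varphi(0+)=C$ if $\frac1t\int_0^t|\varphi(s)-C|\,ds\to 0$ as $t\to0^+$, and let $X$ be the set of those $\varphi\in L^1_{loc}[0,T)$ for which $\varphi(0+)$ exists. With $u$ the Heaviside function and $g_{1-\gamma}(t)=u(t)\,t^{-\gamma}/\Gamma(1-\gamma)$, the Caputo derivative of $\varphi\in X$ is the distribution on $(-\infty,T)$ $$D_c^\gamma\varphi = D\big(g_{1-\gamma}*(u\varphi)\big)-\varphi(0+)\,g_{1-\gamma},$$ where $D$ is the distributional derivative. **Proposition.** Let $E\in C^1(\mathbb R^m,\mathbb R)$ be convex with locally Lipschitz gradient. Let $v:[0,T)\to\mathbb R^m$ (for instance with $T=T_b$ the blow-up time, i.e. $[0,T)$ the maximal interval of existence) be in $X$ and solve, in the sense of distributions on $(-\infty,T)$ and with the right-hand side locally integrable on $[0,T)$ and extended by $0$ to $t<0$, either $$D_c^\gamma v=-\nabla E(v)\qquad\text{or}\qquad D_c^\gamma v=J\,\nabla E(v),$$ where $J$ is a constant linear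 operator on $\mathbb R^m$ with $J^*=-J$. Assume that $E(v)\in X$ and that $D_c^\gamma E(v)$ is a function. Assume moreover that there are $\eta\in C_c^\infty(-\infty,0)$ with $0\le\eta\le1$ and $\int\eta=1$, and a sequence $\epsilon_k\to0^+$, such that, with $\eta_\epsilon(t)=\epsilon^{-1}\eta(t/\epsilon)$ and $v^{\epsilon}=v*\eta_\epsilon$, both $D_c^\gamma E(v^{\epsilon_k})$ and $D_c^\gamma v^{\epsilon_k}$ converge in $L^1_{loc}[0,T)$ as $k\to\infty$, i.e. in $L^1(0,S)$ for every $0<S<T$ (for each such $S$, $v^{\epsilon_k}$ is defined on $[0,S]$ for all large $k$). Then $$E(v(t))\le E(v(0+))\quad\text{for almost every } t\in[0,T),$$ and if $v$ is continuous on $[0,T)$ then $$E(v(t))\le E(v(0))\quad\text{for every } t\in[0,T).$$ -/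

import Mathlib

open MeasureTheory Set Filter TopologicalSpace
open scoped Topology Distributions LineDeriv ContDiff Gradient Convolution

noncomputable section

namespace FracODE

variable {F : Type*} [NormedAddCommGroup F] [NormedSpace ℝ F]

/-- The half-open time interval `[0, T)`, with `T = ⊤` allowed. -/
def timeInterval (T : EReal) : Set ℝ := {t : ℝ | 0 ≤ t ∧ (t : EReal) < T}

/-- The open set `(-∞, T)`, on which the distributions live. -/
def before (T : EReal) : Opens ℝ :=
  ⟨{t : ℝ | (t : EReal) < T}, isOpen_lt continuous_coe_real_ereal continuous_const⟩

/-- The distribution on `(-∞, T)` given by a locally integrable function `f`: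
`ζ ↦ ∫ ζ t • f t`. (It is `0` if `f` is not locally integrable on `(-∞, T)`; every use below
either concerns locally integrable `f` or requires local integrability separately.) -/
def ofFun (T : EReal) (f : ℝ → F) : 𝓓'(before T, F) :=
  ContinuousLinearMap.toUniformConvergenceCLM _ _ _
    (TestFunction.integralAgainstBilinCLM (ContinuousLinearMap.lsmul ℝ ℝ) volume f)

/-- `u(t) φ(t)`, with `u` the Heaviside function. -/
def causal (φ : ℝ → F) : ℝ → F := (Ici (0 : ℝ)).indicator φ

/-- The kernel `g_β(t) = u(t) t^{β - 1} / Γ(β)`, for `β > 0`. -/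
def kernel (β : ℝ) (t : ℝ) : ℝ := if 0 < t then t ^ (β - 1) / Real.Gamma β else 0

/-- `φ(0+) = C` in the averaged sense: `t⁻¹ ∫₀ᵗ |φ - C| → 0` as `t → 0+`. -/
def HasInitialValue (φ : ℝ → F) (C : F) : Prop :=
  Tendsto (fun t : ℝ => t⁻¹ * ∫ s in (0 : ℝ)..t, ‖φ s - C‖) (𝓝[>] 0) (𝓝 0)

/-- The space `X` on `[0, T)`: locally integrable functions on `[0, T)` which have an initial
value `φ(0+)`. -/
def MemX (T : EReal) (φ : ℝ → F) : Prop :=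
  LocallyIntegrableOn φ (timeInterval T) ∧ ∃ C : F, HasInitialValue φ C

open Classical in
/-- The initial value `φ(0+)` (unique if `φ` belongs to `X`). -/
def initialValue (φ : ℝ → F) : F :=
  if h : ∃ C : F, HasInitialValue φ C then h.choose else 0

/-- The modified Riemann-Liouville derivative
`J_{-γ} φ = g_{-γ} * (u φ) = D (g_{1-γ} * (u φ))`, a distribution on `(-∞, T)`. Here `0 < γ < 1`,
`g_{-γ} = D g_{1-γ}`, and `D` is the distributional derivative. For `φ` locally integrable on
`[0, T)`, the convolution `g_{1-γ} * (u φ)` is a Lebesgue integral for almost every `t < T`; it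
uses only values of `φ` on `[0, t]`. -/
def riemannLiouville (γ : ℝ) (T : EReal) (φ : ℝ → F) : 𝓓'(before T, F) :=
  ∂_{(1 : ℝ)} (ofFun T (kernel (1 - γ) ⋆[ContinuousLinearMap.lsmul ℝ ℝ, volume] causal φ))

/-- The Caputo derivative `D_c^γ φ = J_{-γ} φ - φ(0+) g_{1-γ}` of `φ ∈ X`, a distribution on
`(-∞, T)`. For `F = ℝ^m` this amounts to taking the derivative of each component. -/
def caputo (γ : ℝ) (T : EReal) (φ : ℝ → F) : 𝓓'(before T, F) :=
  riemannLiouville γ T φ - ofFun T (fun t => kernel (1 - γ) t • initialValue φ)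

/-- `φ ∈ X`, and the distribution `D_c^γ φ` on `(-∞, T)` is a function (necessarily locally
integrable, in order to be a distribution). -/
def CaputoIsFunction (γ : ℝ) (T : EReal) (φ : ℝ → F) : Prop :=
  MemX T φ ∧ ∃ g : ℝ → F, LocallyIntegrableOn g (before T : Set ℝ) ∧ caputo γ T φ = ofFun T g

/-- `v` solves the autonomous fractional equation `D_c^γ v = f(v)` on `[0, T)`: `v ∈ X`, the
function `f(v)` is locally integrable on `[0, T)`, and the equation holds in the sense of
distributions on `(-∞, T)`. -/
def IsSolution (γ : ℝ) (T : EReal) (f : F → F) (v : ℝ → F) : Prop :=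
  MemX T v ∧ LocallyIntegrableOn (fun t => f (v t)) (timeInterval T) ∧
    caputo γ T v = ofFun T (causal fun t => f (v t))

/-- A mollifier supported in the negative half line: `η ∈ C_c^∞(-∞, 0)`, `0 ≤ η ≤ 1`, `∫ η = 1`. -/
structure IsMollifier (η : ℝ → ℝ) : Prop where
  smooth : ContDiff ℝ ∞ η
  hasCompactSupport : HasCompactSupport η
  tsupport_subset : tsupport η ⊆ Iio 0
  nonneg : ∀ t, 0 ≤ η t
  le_one : ∀ t, η t ≤ 1
  integral_eq_one : ∫ t, η t = 1

/-- `φ^ε = φ * η_ε` with `η_ε(t) = ε⁻¹ η(t / ε)`. If `η` is supported in `[-M, 0)`, its value at `t`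
uses only the values of `φ` on `[t, t + ε M]`. -/
def mollify (η : ℝ → ℝ) (ε : ℝ) (φ : ℝ → F) : ℝ → F :=
  (fun t => ε⁻¹ * η (t / ε)) ⋆[ContinuousLinearMap.lsmul ℝ ℝ, volume] φ

/-- The Caputo derivatives `D_c^γ (ψ k)` converge in `L¹_loc[0, T)` as `k → ∞`, where `ψ k` needs to
be meaningful on `[0, S)` only for `k ≥ k₀(S)`, for each `S < T`: there is `w ∈ L¹_loc[0, T)` such
that for every `0 < S < T` the Caputo derivative of `ψ k` on `(-∞, S)` is, for all large `k`, a
function `f k` that is integrable on `[0, S]`, and `f k → w` in `L¹(0, S)`. -/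
def CaputoConvergesL1loc (γ : ℝ) (T : EReal) (ψ : ℕ → ℝ → F) : Prop :=
  ∃ w : ℝ → F, LocallyIntegrableOn w (timeInterval T) ∧
    ∀ S : ℝ, 0 < S → (S : EReal) < T →
      ∃ f : ℕ → ℝ → F,
        (∀ᶠ k in atTop, MemX (S : EReal) (ψ k) ∧ IntegrableOn (f k) (Icc 0 S) ∧
          caputo γ (S : EReal) (ψ k) = ofFun (S : EReal) (causal (f k))) ∧
        Tendsto (fun k => ∫ t in (0 : ℝ)..S, ‖f k t - w t‖) atTop (𝓝 0)

end FracODE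

end

/-! For a smooth curve x and convex E one has D_c^γ E(x) ≤ E'(x) D_c^γ x. To see this at a time t,
subtract from E its tangent at x(t): p(s) = E(x(s)) - E(x(0)) - E'(x(t))(x(s) - x(0)). By convexity
p is smallest at s = t, and p(0) = 0 gives p(t) ≤ 0. Since g_{1-γ} is decreasing, the backward
difference quotients of g_{1-γ} * p at such a minimum have limit at most 0 (`conv_kernel_sub_le`,
`nonpos_of_hasDerivAt_conv`, `caputo_convex_le`).

The solution v is not smooth, so the inequality is applied to v^ε. The limit of D_c^γ v^ε must be
f(v), where f is the right-hand side of the equation, and E'(x) f(x) ≤ 0 in both the gradient and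
the skew case. Hence the limit W of D_c^γ E(v^ε) is nonpositive. Inverting the Abel operator
(`ae_eq_conv_kernel`), E(v^ε) - E(v^ε(0)) = g_γ * D_c^γ E(v^ε), and in the limit E(v) - E(v(0+)) =
g_γ * W ≤ 0. The mollifier looks only forward in time, so v^ε(0) averages v over short intervals to
the right of 0 and tends to v(0+).

Distributions enter only through `caputo_integrated`, which turns D_c^γ ψ = f into g_{1-γ} * (ψ -
ψ(0+)) = g_1 * f almost everywhere. All limits are taken in this integrated form, where convolution
with an integrable kernel is continuous on L¹. -/

noncomputable section

namespace FracODE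

variable {F : Type*} [NormedAddCommGroup F] [NormedSpace ℝ F]
variable {G : Type*} [NormedAddCommGroup G]

/-! ### Kernels, truncation and causal convolution -/

/-- Convolution of a scalar kernel with a vector-valued function on the line. -/
abbrev conv (a : ℝ → ℝ) (φ : ℝ → F) : ℝ → F := a ⋆[ContinuousLinearMap.lsmul ℝ ℝ, volume] φ

/-- Truncation of a function to `[0, S]`. -/
def cut {G : Type*} [Zero G] (S : ℝ) (φ : ℝ → G) : ℝ → G := (Icc 0 S).indicator φ

theorem kernel_nonneg {β : ℝ} (hβ : 0 < β) (t : ℝ) : 0 ≤ kernel β t := by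
  unfold kernel
  split_ifs with h
  · exact div_nonneg (Real.rpow_nonneg h.le _) (Real.Gamma_pos_of_pos hβ).le
  · exact le_rfl

theorem kernel_of_nonpos {β t : ℝ} (ht : t ≤ 0) : kernel β t = 0 := if_neg ht.not_gt

theorem kernel_of_pos {β t : ℝ} (ht : 0 < t) :
    kernel β t = t ^ (β - 1) / Real.Gamma β := if_pos ht

theorem kernel_one_of_pos {t : ℝ} (ht : 0 < t) : kernel 1 t = 1 := by
  simp [kernel_of_pos ht]

theorem kernel_le_kernel {β s t : ℝ} (hβ : 0 < β) (hβ₁ : β ≤ 1) (hs : 0 < s) (hst : s ≤ t) :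
    kernel β t ≤ kernel β s := by
  rw [kernel_of_pos hs, kernel_of_pos (hs.trans_le hst)]
  exact div_le_div_of_nonneg_right
    (Real.rpow_le_rpow_of_nonpos hs hst (by linarith)) (Real.Gamma_pos_of_pos hβ).le

theorem measurable_kernel (β : ℝ) : Measurable (kernel β) := by
  unfold kernel
  exact Measurable.ite measurableSet_Ioi (by fun_prop) measurable_const

theorem intervalIntegrable_kernel {β : ℝ} (hβ : 0 < β) (a b : ℝ) :
    IntervalIntegrable (kernel β) volume a b := by
  have key : ∀ b : ℝ, IntervalIntegrable (kernel β) volume 0 b := by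
    intro b
    rcases le_or_gt b 0 with hb | hb
    · refine (intervalIntegrable_const (c := (0 : ℝ))).congr fun t ht => ?_
      rw [uIoc_of_ge hb] at ht
      exact (kernel_of_nonpos ht.2).symm
    · refine ((intervalIntegral.intervalIntegrable_rpow' (r := β - 1) (by linarith)).div_const
        (Real.Gamma β)).congr fun t ht => ?_
      rw [uIoc_of_le hb.le] at ht
      exact (kernel_of_pos ht.1).symm
  exact (key a).symm.trans (key b)

theorem locallyIntegrable_kernel {β : ℝ} (hβ : 0 < β) : LocallyIntegrable (kernel β) := by
  rw [locallyIntegrable_iff]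
  intro K hK
  obtain ⟨R, hR⟩ := hK.isBounded.subset_closedBall 0
  rw [Real.closedBall_eq_Icc] at hR
  refine IntegrableOn.mono_set ?_ hR
  rcases le_or_gt (0 - R) (0 + R) with h | h
  · rw [← intervalIntegrable_iff_integrableOn_Icc_of_le h]
    exact intervalIntegrable_kernel hβ _ _
  · rw [Icc_eq_empty h.not_ge]
    exact integrableOn_empty

theorem integrable_cut {S : ℝ} {φ : ℝ → G} (h : IntegrableOn φ (Icc 0 S)) :
    Integrable (cut S φ) := (integrable_indicator_iff measurableSet_Icc).2 h

theorem integrable_cut_kernel {β : ℝ} (hβ : 0 < β) (S : ℝ) : Integrable (cut S (kernel β)) :=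
  integrable_cut ((locallyIntegrable_kernel hβ).integrableOn_isCompact isCompact_Icc)

theorem cut_of_mem {S t : ℝ} (φ : ℝ → G) (h : t ∈ Icc 0 S) : cut S φ t = φ t :=
  indicator_of_mem h φ

theorem cut_of_neg {S t : ℝ} (φ : ℝ → G) (h : t < 0) : cut S φ t = 0 :=
  indicator_of_notMem (fun h' => h.not_ge h'.1) φ

theorem cut_kernel_of_le {β S t : ℝ} (h : t ≤ S) : cut S (kernel β) t = kernel β t := by
  rcases lt_or_ge t 0 with h0 | h0
  · rw [cut_of_neg _ h0, kernel_of_nonpos h0.le]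
  · exact cut_of_mem _ ⟨h0, h⟩

theorem cut_kernel_of_nonpos {β S t : ℝ} (h : t ≤ 0) : cut S (kernel β) t = 0 := by
  rcases le_or_gt t S with h0 | h0
  · rw [cut_kernel_of_le h0, kernel_of_nonpos h]
  · exact indicator_of_notMem (fun h' => h0.not_ge h'.2) _

theorem conv_congr_right {a : ℝ → ℝ} {φ ψ : ℝ → F} {S t : ℝ} (ha : ∀ s ≤ 0, a s = 0)
    (h : ∀ᵐ s, s < S → φ s = ψ s) (ht : t ≤ S) : conv a φ t = conv a ψ t := by
  simp only [conv, convolution_lsmul_swap]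
  refine integral_congr_ae ?_
  filter_upwards [h] with s hs
  rcases lt_or_ge s S with h1 | h1
  · simp [hs h1]
  · simp [ha (t - s) (by linarith)]

theorem conv_congr_left {a b : ℝ → ℝ} {φ : ℝ → F} {S t : ℝ} (h : ∀ s ≤ S, a s = b s)
    (hφ : ∀ s < 0, φ s = 0) (ht : t ≤ S) : conv a φ t = conv b φ t := by
  simp only [conv, convolution_lsmul]
  congr 1
  ext s
  rcases le_or_gt s S with h1 | h1
  · simp [h s h1]
  · simp [hφ (t - s) (by linarith)]

theorem conv_of_neg {a : ℝ → ℝ} {φ : ℝ → F} {t : ℝ} (ha : ∀ s ≤ 0, a s = 0)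
    (hφ : ∀ s < 0, φ s = 0) (ht : t < 0) : conv a φ t = 0 := by
  rw [conv, convolution_lsmul]
  refine integral_eq_zero_of_ae (Eventually.of_forall fun s => ?_)
  rcases le_or_gt s 0 with h1 | h1
  · simp [ha s h1]
  · simp [hφ (t - s) (by linarith)]

/-- Causality: beyond S the kernel only meets values of φ at negative times. The kernel may thus be
made integrable on the whole line without changing the convolution up to time S. -/
theorem conv_cut_kernel {β S t : ℝ} {φ : ℝ → F} (hφ : ∀ s < 0, φ s = 0) (ht : t ≤ S) :
    conv (cut S (kernel β)) φ t = conv (kernel β) φ t :=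
  conv_congr_left (fun _ h => cut_kernel_of_le h) hφ ht

theorem integrable_conv {a : ℝ → ℝ} {φ : ℝ → F} (ha : Integrable a) (hφ : Integrable φ) :
    Integrable (conv a φ) := ha.integrable_convolution _ hφ

theorem integral_norm_conv_le {a : ℝ → ℝ} {φ : ℝ → F} (ha : Integrable a) (hφ : Integrable φ) :
    ∫ t, ‖conv a φ t‖ ≤ (∫ t, ‖a t‖) * ∫ t, ‖φ t‖ := by
  have h := integral_convolution (ContinuousLinearMap.lsmul ℝ ℝ) ha.norm hφ.norm
    (μ := volume) (ν := volume)
  simp only [ContinuousLinearMap.lsmul_apply, smul_eq_mul] at h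
  rw [← h]
  refine integral_mono_of_nonneg (Eventually.of_forall fun t => norm_nonneg _)
    (ha.norm.integrable_convolution _ hφ.norm) (Eventually.of_forall fun t => ?_)
  simp only [convolution_lsmul]
  exact (norm_integral_le_integral_norm _).trans_eq (by simp [norm_smul])

theorem conv_sub {a : ℝ → ℝ} {φ ψ : ℝ → F} (ha : Integrable a) (hφ : Integrable φ)
    (hψ : Integrable ψ) :
    conv a (fun t => φ t - ψ t) =ᵐ[volume] fun t => conv a φ t - conv a ψ t := by
  filter_upwards [ha.ae_convolution_exists (ContinuousLinearMap.lsmul ℝ ℝ) hφ,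
    ha.ae_convolution_exists (ContinuousLinearMap.lsmul ℝ ℝ) hψ] with t h1 h2
  simp only [conv, convolution_lsmul, smul_sub]
  exact integral_sub h1 h2

theorem conv_comm (a b : ℝ → ℝ) : conv a b = conv b a := by
  ext t
  rw [conv, convolution_lsmul_swap, conv, convolution_lsmul]
  simp [mul_comm]

theorem conv_assoc {a b : ℝ → ℝ} {φ : ℝ → F} [CompleteSpace F] (ha : Integrable a)
    (hb : Integrable b) (hφ : Integrable φ) :
    conv (conv a b) φ =ᵐ[volume] conv a (conv b φ) := by
  filter_upwards [ha.norm.ae_convolution_exists (ContinuousLinearMap.mul ℝ ℝ)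
    (hb.norm.integrable_convolution (ContinuousLinearMap.mul ℝ ℝ) hφ.norm)] with t ht
  exact convolution_assoc (ContinuousLinearMap.lsmul ℝ ℝ) (ContinuousLinearMap.lsmul ℝ ℝ)
    (ContinuousLinearMap.lsmul ℝ ℝ) (ContinuousLinearMap.lsmul ℝ ℝ)
    (fun x y z => smul_assoc x y z) ha.aestronglyMeasurable
    hb.aestronglyMeasurable hφ.aestronglyMeasurable (ha.ae_convolution_exists _ hb)
    (hb.norm.ae_convolution_exists _ hφ.norm) ht

theorem conv_kernel_one {φ : ℝ → F} (hφ : ∀ s < 0, φ s = 0) {t : ℝ} (ht : 0 ≤ t) :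
    conv (kernel 1) φ t = ∫ s in (0 : ℝ)..t, φ s := by
  rw [conv, convolution_lsmul_swap, intervalIntegral.integral_of_le ht,
    integral_Ioc_eq_integral_Ioo, ← integral_indicator measurableSet_Ioo]
  have h0 : ∀ᵐ s : ℝ, s ≠ 0 := by simp [ae_iff]
  refine integral_congr_ae ?_
  filter_upwards [h0] with s hs
  by_cases h : s ∈ Ioo 0 t
  · rw [indicator_of_mem h, kernel_one_of_pos (by linarith [h.2]), one_smul]
  · rw [indicator_of_notMem h]
    rcases hs.lt_or_gt with h1 | h1
    · simp [hφ s h1]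
    · rw [kernel_of_nonpos, zero_smul]
      by_contra h2
      exact h ⟨h1, by linarith⟩

/-! ### Beta integral and inversion of the Abel operator -/

/-- The scaled Beta integral; a + b = 1 removes the power of t and makes Γ(a + b) = 1. -/
theorem integral_rpow_mul_rpow_sub {a b t : ℝ} (ha : 0 < a) (hb : 0 < b) (hab : a + b = 1)
    (ht : 0 < t) :
    ∫ s in (0 : ℝ)..t, s ^ (a - 1) * (t - s) ^ (b - 1) = Real.Gamma a * Real.Gamma b := by
  have h := Complex.betaIntegral_scaled (a : ℂ) (b : ℂ) ht
  have h2 := Complex.Gamma_mul_Gamma_eq_betaIntegral (s := (a : ℂ)) (t := (b : ℂ))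
    (by simpa using ha) (by simpa using hb)
  have hab' : (a : ℂ) + b = 1 := by exact_mod_cast hab
  rw [hab', Complex.Gamma_one, one_mul] at h2
  rw [hab', sub_self, Complex.cpow_zero, one_mul, ← h2, Complex.Gamma_ofReal,
    Complex.Gamma_ofReal] at h
  have h3 : (∫ s in (0 : ℝ)..t, (s : ℂ) ^ ((a : ℂ) - 1) * ((t : ℂ) - s) ^ ((b : ℂ) - 1)) =
      ((∫ s in (0 : ℝ)..t, s ^ (a - 1) * (t - s) ^ (b - 1) : ℝ) : ℂ) := by
    rw [← intervalIntegral.integral_ofReal]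
    refine intervalIntegral.integral_congr fun s hs => ?_
    rw [uIcc_of_le ht.le] at hs
    simp only [Complex.ofReal_mul]
    rw [Complex.ofReal_cpow hs.1, Complex.ofReal_cpow (by linarith [hs.2])]
    push_cast
    rfl
  rw [h3] at h
  exact_mod_cast h

theorem conv_kernel_kernel {a b : ℝ} (ha : 0 < a) (hb : 0 < b) (hab : a + b = 1) :
    conv (kernel a) (kernel b) = kernel 1 := by
  ext t
  rcases le_or_gt t 0 with ht | ht
  · rw [kernel_of_nonpos ht, conv, convolution_lsmul]
    refine integral_eq_zero_of_ae (Eventually.of_forall fun s => ?_)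
    rcases le_or_gt s 0 with h1 | h1
    · simp [kernel_of_nonpos h1]
    · simp [kernel_of_nonpos (show t - s ≤ 0 by linarith)]
  · have hΓ : Real.Gamma a * Real.Gamma b ≠ 0 :=
      (mul_pos (Real.Gamma_pos_of_pos ha) (Real.Gamma_pos_of_pos hb)).ne'
    rw [kernel_one_of_pos ht, ← div_self hΓ]
    nth_rewrite 1 [← integral_rpow_mul_rpow_sub ha hb hab ht]
    rw [← intervalIntegral.integral_div, conv, convolution_lsmul,
      intervalIntegral.integral_of_le ht.le, integral_Ioc_eq_integral_Ioo,
      ← integral_indicator measurableSet_Ioo]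
    congr 1
    ext s
    by_cases h : s ∈ Ioo 0 t
    · rw [indicator_of_mem h, kernel_of_pos h.1, kernel_of_pos (by linarith [h.2]), smul_eq_mul]
      field_simp
    · rw [indicator_of_notMem h, smul_eq_mul]
      by_cases h1 : 0 < s
      · rw [kernel_of_nonpos (t := t - s), mul_zero]
        by_contra h2
        exact h ⟨h1, by linarith⟩
      · rw [kernel_of_nonpos (not_lt.1 h1), zero_mul]

/-- Convolution with `kernel 1` is the primitive from 0. Being continuous, it vanishes everywhere on
(0, S), and Lebesgue differentiation recovers φ. -/
theorem ae_eq_zero_of_conv_kernel_one [CompleteSpace F] {S : ℝ} {φ : ℝ → F}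
    (hφ : Integrable φ) (h0 : ∀ s < 0, φ s = 0)
    (h : ∀ᵐ t, t < S → conv (kernel 1) φ t = 0) : ∀ᵐ t, t < S → φ t = 0 := by
  have hc : Continuous fun t => ∫ s in (0 : ℝ)..t, φ s :=
    intervalIntegral.continuous_primitive (fun a b => hφ.intervalIntegrable) 0
  have hz : ∀ t ∈ Ioo 0 S, ∫ s in (0 : ℝ)..t, φ s = 0 := by
    have h1 : ∀ᵐ t ∂(volume.restrict (Ioo 0 S)), ∫ s in (0 : ℝ)..t, φ s = 0 := by
      rw [ae_restrict_iff' measurableSet_Ioo]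
      filter_upwards [h] with t ht hm
      rw [← conv_kernel_one h0 hm.1.le, ht hm.2]
    exact Measure.eqOn_open_of_ae_eq h1 isOpen_Ioo hc.continuousOn continuousOn_const
  have hne : ∀ᵐ t : ℝ, t ≠ 0 := by simp [ae_iff]
  filter_upwards [_root_.LocallyIntegrable.ae_hasDerivAt_integral hφ.locallyIntegrable, hne]
    with t ht ht0 htS
  rcases ht0.lt_or_gt with h1 | h1
  · exact h0 t h1
  · have h2 : HasDerivAt (fun t => ∫ s in (0 : ℝ)..t, φ s) 0 t :=
      (hasDerivAt_const t (0 : F)).congr_of_eventuallyEq (by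
        filter_upwards [Ioo_mem_nhds h1 htS] with r hr using hz r hr)
    exact (ht 0).unique h2

theorem ae_eq_of_conv_kernel_one [CompleteSpace F] {S : ℝ} {φ ψ : ℝ → F} (hφ : Integrable φ)
    (hψ : Integrable ψ) (hφ0 : ∀ s < 0, φ s = 0) (hψ0 : ∀ s < 0, ψ s = 0)
    (h : ∀ᵐ t, t < S → conv (kernel 1) φ t = conv (kernel 1) ψ t) :
    ∀ᵐ t, t < S → φ t = ψ t := by
  have hd0 : ∀ s < 0, φ s - ψ s = 0 := fun s hs => by rw [hφ0 s hs, hψ0 s hs, sub_zero]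
  have key : ∀ᵐ t, t < S → conv (kernel 1) (fun s => φ s - ψ s) t = 0 := by
    filter_upwards [h, conv_sub (integrable_cut_kernel one_pos S) hφ hψ] with t h1 h2 hS
    rw [conv_cut_kernel hd0 hS.le, conv_cut_kernel hφ0 hS.le, conv_cut_kernel hψ0 hS.le,
      h1 hS, sub_self] at h2
    exact h2
  filter_upwards [ae_eq_zero_of_conv_kernel_one (hφ.sub hψ) hd0 key] with t ht hS
  exact sub_eq_zero.1 (ht hS)

/-- Inversion of the Abel integral operator. -/
theorem ae_eq_conv_kernel [CompleteSpace F] {γ S : ℝ} (hγ₀ : 0 < γ) (hγ₁ : γ < 1)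
    {φ f : ℝ → F} (hφ : Integrable φ) (hf : Integrable f) (hφ0 : ∀ s < 0, φ s = 0)
    (hf0 : ∀ s < 0, f s = 0)
    (h : ∀ᵐ t, t < S → conv (kernel (1 - γ)) φ t = conv (kernel 1) f t) :
    ∀ᵐ t, t < S → φ t = conv (kernel γ) f t := by
  set a := cut S (kernel γ)
  set b := cut S (kernel (1 - γ))
  set u := cut S (kernel 1)
  have ha : Integrable a := integrable_cut_kernel hγ₀ S
  have hb : Integrable b := integrable_cut_kernel (by linarith) S
  have hu : Integrable u := integrable_cut_kernel one_pos S
  have ha0 : ∀ s ≤ 0, a s = 0 := fun s hs => cut_kernel_of_nonpos hs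
  have hb0 : ∀ s ≤ 0, b s = 0 := fun s hs => cut_kernel_of_nonpos hs
  have haf0 : ∀ s < 0, conv a f s = 0 := fun s hs => conv_of_neg ha0 hf0 hs
  have hab : ∀ t ≤ S, conv a b t = kernel 1 t := by
    intro t ht
    rw [conv_cut_kernel (fun s hs => hb0 s hs.le) ht, conv_comm,
      conv_cut_kernel (fun s hs => kernel_of_nonpos hs.le) ht, conv_comm,
      conv_kernel_kernel hγ₀ (by linarith) (by ring)]
  have hbu : ∀ᵐ t, t < S → conv b φ t = conv u f t := by
    filter_upwards [h] with t ht hS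
    rw [conv_cut_kernel hφ0 hS.le, conv_cut_kernel hf0 hS.le, ht hS]
  -- With all kernels truncated so that Fubini applies: g_1 * φ = g_γ * g_{1-γ} * φ = g_γ * g_1 * f
  -- = g_1 * (g_γ * f). Injectivity of g_1 * then finishes.
  have key : ∀ᵐ t, t < S → conv (kernel 1) φ t = conv (kernel 1) (conv a f) t := by
    filter_upwards [conv_assoc ha hb hφ, conv_assoc ha hu hf, conv_assoc hu ha hf]
      with t h1 h2 h3 hS
    rw [← conv_congr_left hab hφ0 hS.le, h1, conv_congr_right ha0 hbu hS.le, ← h2, conv_comm, h3,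
      conv_cut_kernel haf0 hS.le]
  filter_upwards [ae_eq_of_conv_kernel_one hφ (integrable_conv ha hf) hφ0 haf0 key] with t ht hS
  rw [ht hS, conv_cut_kernel hf0 hS.le]

/-! ### From distributions to integrated equations -/

theorem locallyIntegrableOn_before {T : EReal} (hT : 0 < T) {f : ℝ → G}
    (h : ∀ S : ℝ, 0 < S → (S : EReal) < T → ∃ g : ℝ → G, Integrable g ∧ ∀ t < S, f t = g t) :
    LocallyIntegrableOn f (before T : Set ℝ) := by
  intro t ht
  obtain ⟨S, hS, hST⟩ := EReal.lt_iff_exists_real_btwn.1 (max_lt (show (t : EReal) < T from ht) hT)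
  have h1 : t < S := by exact_mod_cast (le_max_left _ _).trans_lt hS
  have h2 : 0 < S := by exact_mod_cast (le_max_right _ _).trans_lt hS
  obtain ⟨g, hg, hfg⟩ := h S h2 hST
  exact ⟨Iio S, mem_nhdsWithin_of_mem_nhds (Iio_mem_nhds h1),
    hg.integrableOn.congr_fun (fun s hs => (hfg s hs).symm) measurableSet_Iio⟩

theorem integrableOn_Icc_of_timeInterval {T : EReal} {f : ℝ → G} {S : ℝ}
    (hf : LocallyIntegrableOn f (timeInterval T)) (hS : (S : EReal) < T) :
    IntegrableOn f (Icc 0 S) :=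
  hf.integrableOn_compact_subset
    (fun _ ht => ⟨ht.1, (EReal.coe_le_coe_iff.2 ht.2).trans_lt hS⟩) isCompact_Icc

theorem causal_eq_cut {S t : ℝ} (φ : ℝ → G) (ht : t ≤ S) : causal φ t = cut S φ t := by
  by_cases h : 0 ≤ t
  · rw [cut_of_mem φ ⟨h, ht⟩, causal, indicator_of_mem (show t ∈ Ici 0 from h)]
  · rw [cut_of_neg φ (not_le.1 h), causal, indicator_of_notMem (show t ∉ Ici 0 from h)]

theorem conv_kernel_causal {β S t : ℝ} {φ : ℝ → F} (ht : t ≤ S) :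
    conv (kernel β) (causal φ) t = conv (cut S (kernel β)) (cut S φ) t := by
  rw [conv_congr_right (fun s hs => kernel_of_nonpos hs)
    (Eventually.of_forall fun s hs => causal_eq_cut φ (le_of_lt hs)) ht,
    conv_cut_kernel (fun s hs => cut_of_neg φ hs) ht]

theorem ofFun_apply {T : EReal} {f : ℝ → F} (hf : LocallyIntegrableOn f (before T : Set ℝ))
    (ζ : 𝓓(before T, ℝ)) : ofFun T f ζ = ∫ t, ζ t • f t :=
  TestFunction.integralAgainstBilinCLM_eq_integral hf

theorem deriv_ofFun_apply {T : EReal} {f : ℝ → F}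
    (hf : LocallyIntegrableOn f (before T : Set ℝ)) (ζ : 𝓓(before T, ℝ)) :
    (∂_{(1 : ℝ)} (ofFun T f)) ζ = -∫ t, deriv ζ t • f t := by
  rw [Distribution.lineDerivOp_apply_apply, map_neg, ofFun_apply hf]
  congr 2

/-- Integration by parts against a primitive. -/
theorem integral_smul_eq_neg_integral_deriv_smul {ζ : ℝ → ℝ} (hζ : ContDiff ℝ 1 ζ)
    (hc : HasCompactSupport ζ) {B : ℝ → F} [CompleteSpace F] (hB : Integrable B) :
    ∫ t, ζ t • B t = -∫ t, deriv ζ t • conv (kernel 1) B t := by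
  have hdc : Continuous (deriv ζ) := hζ.continuous_deriv le_rfl
  have hdi : Integrable (deriv ζ) := hdc.integrable_of_hasCompactSupport hc.deriv
  have hk : ∀ r, ‖kernel 1 r‖ ≤ 1 := by
    intro r
    rcases le_or_gt r 0 with h | h
    · simp [kernel_of_nonpos h]
    · simp [kernel_one_of_pos h]
  have hprod : Integrable (Function.uncurry fun t s => deriv ζ t • kernel 1 (t - s) • B s)
      (volume.prod volume) := by
    have h1 : Integrable (fun z : ℝ × ℝ => kernel 1 (z.1 - z.2) • (deriv ζ z.1 • B z.2))
        (volume.prod volume) :=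
      (hdi.smul_prod hB).bdd_smul 1
        ((measurable_kernel 1).comp (measurable_fst.sub measurable_snd)).aestronglyMeasurable
        (Eventually.of_forall fun z => hk _)
    refine h1.congr (Eventually.of_forall fun z => ?_)
    simp only [Function.uncurry]
    rw [smul_comm]
  have h1 : ∀ t, deriv ζ t • conv (kernel 1) B t
      = ∫ s, deriv ζ t • kernel 1 (t - s) • B s := by
    intro t
    rw [integral_smul, conv, convolution_lsmul_swap]
  simp_rw [h1]
  -- After Fubini the inner integral is that of ζ' over (s, ∞), which is -ζ(s).
  rw [integral_integral_swap hprod, ← integral_neg]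
  congr 1
  ext s
  have h2 : ∀ t, deriv ζ t • kernel 1 (t - s) • B s
      = ((Ioi s).indicator (deriv ζ) t) • B s := by
    intro t
    by_cases h : s < t
    · rw [indicator_of_mem (show t ∈ Ioi s from h), kernel_one_of_pos (by linarith), one_smul]
    · rw [indicator_of_notMem (show t ∉ Ioi s from h), kernel_of_nonpos (by linarith), zero_smul,
        smul_zero]
  simp_rw [h2]
  rw [integral_smul_const, integral_indicator measurableSet_Ioi,
    hc.integral_Ioi_deriv_eq hζ, neg_smul, neg_neg]

/-- A function on `(-∞, S)` with vanishing derivative which vanishes near `-∞` is zero. -/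
theorem ae_eq_zero_of_integral_deriv_smul {S : ℝ} (hS : 0 < S) {D : ℝ → F} [CompleteSpace F]
    (hD : Integrable D) (hD0 : ∀ t < 0, D t = 0)
    (h : ∀ ζ : ℝ → ℝ, ContDiff ℝ ∞ ζ → HasCompactSupport ζ → tsupport ζ ⊆ Iio S →
      ∫ t, deriv ζ t • D t = 0) : ∀ᵐ t, t < S → D t = 0 := by
  refine isOpen_Iio.ae_eq_zero_of_integral_contDiff_smul_eq_zero
    (hD.locallyIntegrable.locallyIntegrableOn (Iio S)) fun χ hχ hχc hχS => ?_
  -- An arbitrary χ is corrected by a multiple of a bump of mass one. The result θ has mean zero, so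
  -- its primitive is a test function. The bump lives in [-3/2, -1/2], where D vanishes, so the
  -- correction does not change the pairing with D.
  let bump : ContDiffBump (-1 : ℝ) := ⟨1 / 4, 1 / 2, by norm_num, by norm_num⟩
  set ρ : ℝ → ℝ := bump.normed volume with hρ
  have hρs : ContDiff ℝ ∞ ρ := bump.contDiff_normed
  have hρc : HasCompactSupport ρ := bump.hasCompactSupport_normed
  have hρt : tsupport ρ ⊆ Iio 0 := by
    rw [hρ, bump.tsupport_normed_eq, Real.closedBall_eq_Icc]
    intro t ht
    have := ht.2
    simp only [bump] at this
    norm_num at this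
    exact lt_of_le_of_lt this (by norm_num)
  set c : ℝ := ∫ t, χ t
  set θ : ℝ → ℝ := fun t => χ t - c * ρ t with hθ
  have hθs : ContDiff ℝ ∞ θ := hχ.sub (contDiff_const.mul hρs)
  obtain ⟨A, R, hAR, hRS, hzero⟩ : ∃ A R : ℝ, A ≤ R ∧ R < S ∧ ∀ t ∉ Icc A R, θ t = 0 := by
    -- The extra point -1 ensures nonemptiness, so that greatest and least elements exist.
    have hK : IsCompact (insert (-1 : ℝ) (tsupport χ ∪ tsupport ρ)) :=
      (hχc.isCompact.union hρc.isCompact).insert _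
    obtain ⟨R, hR, hRu⟩ := hK.exists_isGreatest (insert_nonempty _ _)
    obtain ⟨A, hA, hAl⟩ := hK.exists_isLeast (insert_nonempty _ _)
    refine ⟨A, R, hRu hA, ?_, fun t ht => ?_⟩
    · rcases hR with rfl | hR | hR
      · linarith
      · exact hχS hR
      · exact (show R < 0 from hρt hR).trans hS
    · have h1 : χ t = 0 := by
        by_contra h1
        have : t ∈ insert (-1 : ℝ) (tsupport χ ∪ tsupport ρ) :=
          Or.inr (Or.inl (subset_tsupport χ h1))
        exact ht ⟨hAl this, hRu this⟩
      have h2 : ρ t = 0 := by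
        by_contra h2
        have : t ∈ insert (-1 : ℝ) (tsupport χ ∪ tsupport ρ) :=
          Or.inr (Or.inr (subset_tsupport ρ h2))
        exact ht ⟨hAl this, hRu this⟩
      simp [hθ, h1, h2]
  have hχi : Integrable χ := hχ.continuous.integrable_of_hasCompactSupport hχc
  have hρi : Integrable ρ := hρs.continuous.integrable_of_hasCompactSupport hρc
  have hθ0 : ∫ t, θ t = 0 := by
    rw [hθ, integral_sub hχi (hρi.const_mul c), integral_const_mul, bump.integral_normed, mul_one,
      sub_self]
  set ζ : ℝ → ℝ := fun t => ∫ s in A..t, θ s with hζ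
  have hderiv : ∀ t, HasDerivAt ζ (θ t) t := fun t =>
    intervalIntegral.integral_hasDerivAt_right (hθs.continuous.intervalIntegrable _ _)
      (hθs.continuous.stronglyMeasurableAtFilter _ _) hθs.continuous.continuousAt
  have hdeq : deriv ζ = θ := funext fun t => (hderiv t).deriv
  have hζs : ContDiff ℝ ∞ ζ := by
    rw [contDiff_infty_iff_deriv, hdeq]
    exact ⟨fun t => (hderiv t).differentiableAt, hθs⟩
  have hζ0 : ∀ t ∉ Icc A R, ζ t = 0 := by
    intro t ht
    rcases lt_or_ge t A with h1 | h1
    · simp only [hζ]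
      rw [intervalIntegral.integral_symm, intervalIntegral.integral_of_le h1.le,
        integral_Ioc_eq_integral_Ioo, setIntegral_eq_zero_of_forall_eq_zero, neg_zero]
      exact fun s hs => hzero s fun h2 => h2.1.not_gt hs.2
    · have h2 : R < t := by
        by_contra h2
        exact ht ⟨h1, not_lt.1 h2⟩
      rw [← hθ0, hζ]
      simp only
      rw [intervalIntegral.integral_of_le h1, ← integral_Icc_eq_integral_Ioc,
        setIntegral_eq_integral_of_forall_compl_eq_zero]
      intro s hs
      exact hzero s fun h3 => hs ⟨h3.1, h3.2.trans h2.le⟩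
  have hsupp : tsupport ζ ⊆ Icc A R :=
    closure_minimal (fun t ht => by_contra fun h1 => ht (hζ0 t h1)) isClosed_Icc
  have hmain := h ζ hζs (HasCompactSupport.intro isCompact_Icc hζ0)
    (hsupp.trans fun t ht => ht.2.trans_lt hRS)
  rw [hdeq] at hmain
  rw [← hmain]
  congr 1
  ext t
  rcases lt_or_ge t 0 with h1 | h1
  · simp [hD0 t h1]
  · have : ρ t = 0 := by
      by_contra h2
      exact absurd (show t < 0 from hρt (subset_tsupport ρ h2)) h1.not_gt
    simp [hθ, this]

/-- The integrated form of a Caputo equation `D_c^γ ψ = f`. -/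
theorem caputo_integrated {γ : ℝ} (hγ₁ : γ < 1) {T : EReal} [CompleteSpace F] {ψ f : ℝ → F}
    (hψ : LocallyIntegrableOn ψ (timeInterval T)) (hf : LocallyIntegrableOn f (timeInterval T))
    (h : caputo γ T ψ = ofFun T (causal f)) {S : ℝ} (hS : 0 < S) (hST : (S : EReal) < T) :
    ∀ᵐ t, t < S → conv (kernel (1 - γ)) (cut S fun s => ψ s - initialValue ψ) t =
      conv (kernel 1) (cut S f) t := by
  set C := initialValue ψ with hC
  have hT : 0 < T := (EReal.coe_pos.2 hS).trans hST
  have hψi : ∀ S : ℝ, (S : EReal) < T → Integrable (cut S ψ) := fun S hS =>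
    integrable_cut (integrableOn_Icc_of_timeInterval hψ hS)
  have hfi : ∀ S : ℝ, (S : EReal) < T → Integrable (cut S f) := fun S hS =>
    integrable_cut (integrableOn_Icc_of_timeInterval hf hS)
  have hγ : 0 < 1 - γ := by linarith
  have hk : ∀ S, Integrable (cut S (kernel (1 - γ))) := integrable_cut_kernel hγ
  have hH : LocallyIntegrableOn (conv (kernel (1 - γ)) (causal ψ)) (before T : Set ℝ) :=
    locallyIntegrableOn_before hT fun S _ hS => ⟨_, integrable_conv (hk S) (hψi S hS),
      fun t ht => conv_kernel_causal ht.le⟩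
  have hKC : LocallyIntegrableOn (fun t => kernel (1 - γ) t • C) (before T : Set ℝ) :=
    locallyIntegrableOn_before hT fun S _ hS => ⟨fun t => cut S (kernel (1 - γ)) t • C,
      (hk S).smul_const C, fun t ht => by simp only [cut_kernel_of_le ht.le]⟩
  have hcf : LocallyIntegrableOn (causal f) (before T : Set ℝ) :=
    locallyIntegrableOn_before hT fun S _ hS => ⟨cut S f, hfi S hS,
      fun t ht => causal_eq_cut f ht.le⟩
  set b := cut S (kernel (1 - γ)) with hb
  set u := cut S (kernel 1) with hu
  have hbi : Integrable b := hk S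
  have hui : Integrable u := integrable_cut_kernel one_pos S
  have hb0 : ∀ s ≤ 0, b s = 0 := fun s hs => cut_kernel_of_nonpos hs
  have hu0 : ∀ s ≤ 0, u s = 0 := fun s hs => cut_kernel_of_nonpos hs
  have huC : Integrable fun t => u t • C := hui.smul_const C
  have hcutsub : ∀ᵐ s, s < S → cut S (fun s => ψ s - C) s = cut S ψ s - u s • C := by
    have hne : ∀ᵐ t : ℝ, t ≠ 0 := by simp [ae_iff]
    filter_upwards [hne] with s hs hsS
    rcases hs.lt_or_gt with h1 | h1
    · simp [cut_of_neg _ h1, hu0 s h1.le]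
    · rw [cut_of_mem _ ⟨h1.le, hsS.le⟩, cut_of_mem _ ⟨h1.le, hsS.le⟩, hu,
        cut_kernel_of_le hsS.le, kernel_one_of_pos h1, one_smul]
  -- The initial-value term g_{1-γ} C is thereby the derivative of g_{1-γ} * (u C), and can be
  -- absorbed under the same derivative as ψ.
  have hbu : ∀ t ≤ S, conv b (fun t => u t • C) t = conv (kernel 1) (fun t => b t • C) t := by
    intro t ht
    have e1 : conv b (fun t => u t • C) t = conv b u t • C := by
      simp only [conv, convolution_lsmul]
      rw [← integral_smul_const]
      simp [mul_smul]
    have e2 : conv (kernel 1) (fun t => b t • C) t = conv (kernel 1) b t • C := by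
      simp only [conv, convolution_lsmul]
      rw [← integral_smul_const]
      simp [mul_smul]
    rw [e1, e2, conv_comm, hu, conv_cut_kernel (fun s hs => hb0 s hs.le) ht]
  -- The difference of the two sides, truncated. It vanishes for t < 0, so it suffices that its
  -- distributional derivative is zero on (-∞, S).
  set D : ℝ → F := fun t => conv b (fun s => cut S ψ s - u s • C) t - conv u (cut S f) t with hD
  have hcf0 : ∀ s < 0, cut S f s = 0 := fun s hs => cut_of_neg f hs
  have hD0 : ∀ t < 0, D t = 0 := by
    intro t ht
    simp only [hD]
    rw [conv_of_neg hb0 (fun s hs => by simp [cut_of_neg _ hs, hu0 s hs.le]) ht,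
      conv_of_neg hu0 hcf0 ht, sub_zero]
  have hDi : Integrable D :=
    (integrable_conv hbi ((hψi S hST).sub huC)).sub (integrable_conv hui (hfi S hST))
  have key : ∀ᵐ t, t < S → D t = 0 := by
    refine ae_eq_zero_of_integral_deriv_smul hS hDi hD0 fun ζ hζ hζc hζS => ?_
    have hζT : tsupport ζ ⊆ before T := fun t ht =>
      (EReal.coe_lt_coe_iff.2 (hζS ht)).trans hST
    let Z : 𝓓(before T, ℝ) := ⟨ζ, hζ, hζc, hζT⟩
    have hζ0 : ∀ t, S ≤ t → ζ t = 0 := fun t ht => by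
      by_contra h1
      exact ht.not_gt (hζS (subset_tsupport ζ h1))
    have hdζ0 : ∀ t, S ≤ t → deriv ζ t = 0 := fun t ht => by
      by_contra h1
      exact ht.not_gt (hζS (support_deriv_subset h1))
    have e := congrArg (fun d : 𝓓'(before T, F) => d Z) h
    have e1 : caputo γ T ψ Z = (∂_{(1 : ℝ)} (ofFun T (conv (kernel (1 - γ)) (causal ψ)))) Z -
      ofFun T (fun t => kernel (1 - γ) t • C) Z := rfl
    replace e : caputo γ T ψ Z = ofFun T (causal f) Z := e
    rw [e1, deriv_ofFun_apply hH, ofFun_apply hKC, ofFun_apply hcf] at e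
    have hd : ∀ X : ℝ → F, Integrable X → Integrable fun t => deriv ζ t • X t := fun X hX =>
      hX.smul_of_top_right
        ((hζ.continuous_deriv (by simp)).memLp_top_of_hasCompactSupport hζc.deriv _)
    have hζ1 : ContDiff ℝ 1 ζ := hζ.of_le (by simp)
    have hI : ∀ X Y : ℝ → F, (∀ t < S, X t = Y t) →
        ∫ t, deriv ζ t • X t = ∫ t, deriv ζ t • Y t := fun X Y hXY => by
      congr 1
      ext t
      rcases lt_or_ge t S with h1 | h1
      · rw [hXY t h1]
      · rw [hdζ0 t h1, zero_smul, zero_smul]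
    have hJ : ∀ X Y : ℝ → F, (∀ t < S, X t = Y t) →
        ∫ t, ζ t • X t = ∫ t, ζ t • Y t := fun X Y hXY => by
      congr 1
      ext t
      rcases lt_or_ge t S with h1 | h1
      · rw [hXY t h1]
      · rw [hζ0 t h1, zero_smul, zero_smul]
    have e2 : ∫ t, Z t • causal f t = -∫ t, deriv ζ t • conv u (cut S f) t := by
      refine (hJ (causal f) (cut S f) fun t ht => causal_eq_cut f ht.le).trans ?_
      rw [integral_smul_eq_neg_integral_deriv_smul hζ1 hζc (hfi S hST)]
      rw [hI _ _ fun t ht => (conv_cut_kernel hcf0 ht.le).symm]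
    have e3 : ∫ t, Z t • kernel (1 - γ) t • C
        = -∫ t, deriv ζ t • conv b (fun t => u t • C) t := by
      refine (hJ (fun t => kernel (1 - γ) t • C) (fun t => b t • C)
        fun t ht => by simp only [hb, cut_kernel_of_le ht.le]).trans ?_
      rw [integral_smul_eq_neg_integral_deriv_smul hζ1 hζc (hbi.smul_const C)]
      rw [hI _ _ fun t ht => (hbu t ht.le).symm]
    have e4 : ∫ t, deriv Z t • conv (kernel (1 - γ)) (causal ψ) t
        = ∫ t, deriv ζ t • conv b (cut S ψ) t := hI _ _ fun t ht => conv_kernel_causal ht.le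
    have e5 : ∫ t, deriv ζ t • D t = ∫ t, (deriv ζ t • conv b (cut S ψ) t
        - deriv ζ t • conv b (fun t => u t • C) t - deriv ζ t • conv u (cut S f) t) := by
      refine integral_congr_ae ?_
      filter_upwards [conv_sub hbi (hψi S hST) huC] with t ht
      simp only [hD]
      rw [ht, smul_sub, smul_sub]
    have hX := hd _ (integrable_conv hbi (hψi S hST))
    have hY := hd _ (integrable_conv hbi huC)
    have e6 := integral_sub (hX.sub hY) (hd _ (integrable_conv hui (hfi S hST)))
    simp only [Pi.sub_apply] at e6
    rw [e5, e6, integral_sub hX hY]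
    rw [e2, e3, e4, sub_neg_eq_add, neg_add_eq_sub] at e
    have e7 := congrArg Neg.neg e
    rw [neg_sub, neg_neg] at e7
    rw [e7, sub_self]
  filter_upwards [key] with t ht htS
  have e := sub_eq_zero.1 (ht htS)
  rw [← conv_congr_right hb0 hcutsub htS.le, hb, hu, conv_cut_kernel hcf0 htS.le,
    conv_cut_kernel (fun s hs => cut_of_neg _ hs) htS.le] at e
  exact e

/-! ### Fractional minimum principle and the convexity inequality -/

/-- Allows one-sided limits to be compared along points where an almost-everywhere statement holds.
-/
theorem frequently_nhdsGT_of_ae {P : ℝ → Prop} (h : ∀ᵐ r, P r) (a : ℝ) : ∃ᶠ r in 𝓝[>] a, P r := by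
  intro hn
  obtain ⟨b, hb, hs⟩ := mem_nhdsGT_iff_exists_Ioo_subset.1 hn
  have h0 : volume (Ioo a b) = 0 := measure_mono_null hs h
  rw [Real.volume_Ioo, ENNReal.ofReal_eq_zero, sub_nonpos] at h0
  exact h0.not_gt hb

/-- Continuity of p gives integrability at every t, not just almost every t, so convolutions can be
split at a prescribed point. -/
theorem integrable_kernel_smul_cut {β : ℝ} (hβ : 0 < β) {S : ℝ} {p : ℝ → F}
    (hp : ContinuousOn p (Icc 0 S)) (t : ℝ) :
    Integrable fun s => kernel β (t - s) • cut S p s := by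
  have h1 : (fun s => kernel β (t - s) • cut S p s)
      = (Icc 0 S).indicator fun s => kernel β (t - s) • p s := by
    ext s
    by_cases h : s ∈ Icc 0 S
    · rw [cut_of_mem _ h, indicator_of_mem h]
    · rw [cut, indicator_of_notMem h, indicator_of_notMem h, smul_zero]
  rw [h1, integrable_indicator_iff measurableSet_Icc]
  refine IntegrableOn.smul_continuousOn ?_ hp isCompact_Icc
  rcases le_or_gt 0 S with h | h
  · rw [← intervalIntegrable_iff_integrableOn_Icc_of_le h]
    simpa using (intervalIntegrable_kernel hβ (t - 0) (t - S)).comp_sub_left t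
  · rw [Icc_eq_empty h.not_ge]
    exact integrableOn_empty

theorem conv_kernel_cut_one {β S t : ℝ} (ht : 0 ≤ t) (htS : t ≤ S) :
    conv (kernel β) (cut S (kernel 1)) t = ∫ s in (0 : ℝ)..t, kernel β s := by
  rw [conv_comm, conv_cut_kernel (fun s hs => kernel_of_nonpos hs.le) htS,
    conv_kernel_one (fun s hs => kernel_of_nonpos hs.le) ht]

theorem integral_kernel_mono {β : ℝ} (hβ : 0 < β) {r t : ℝ} (hrt : r ≤ t) :
    ∫ s in (0 : ℝ)..r, kernel β s ≤ ∫ s in (0 : ℝ)..t, kernel β s := by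
  rw [← sub_nonneg, intervalIntegral.integral_interval_sub_left
    (intervalIntegrable_kernel hβ _ _) (intervalIntegrable_kernel hβ _ _)]
  exact intervalIntegral.integral_nonneg hrt fun s _ => kernel_nonneg hβ s

/-- Backward increments of `k * p` at a minimum point of `p` at which `p` is nonpositive. -/
theorem conv_kernel_sub_le {β : ℝ} (hβ : 0 < β) (hβ₁ : β ≤ 1) {S t δ c : ℝ} {p : ℝ → ℝ}
    (hp : ContinuousOn p (Icc 0 S)) (hδ : 0 < δ) (hδt : δ ≤ t) (htS : t ≤ S) (hpt : p t ≤ 0)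
    (hmin : ∀ s ∈ Icc 0 S, p t ≤ p s) (hc : ∀ s ∈ Icc (t - δ) t, p s ≤ p t + c) :
    conv (kernel β) (cut S p) t - conv (kernel β) (cut S p) (t - δ) ≤
      c * ∫ s in (0 : ℝ)..δ, kernel β s := by
  have hu : ContinuousOn (fun _ : ℝ => (1 : ℝ)) (Icc 0 S) := continuousOn_const
  have hone : ∀ r ≤ S, 0 ≤ r → ∫ s, kernel β (r - s) • cut S (fun _ => (1 : ℝ)) s
      = ∫ s in (0 : ℝ)..r, kernel β s := by
    intro r hrS hr
    rw [← conv_kernel_cut_one hr hrS, conv, convolution_lsmul_swap]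
    have hne : ∀ᵐ t : ℝ, t ≠ 0 := by simp [ae_iff]
    refine integral_congr_ae ?_
    filter_upwards [hne] with s hs
    by_cases h : s ∈ Icc 0 S
    · rw [cut_of_mem _ h, cut_of_mem _ h, kernel_one_of_pos (lt_of_le_of_ne h.1 hs.symm)]
    · rw [cut, cut, indicator_of_notMem h, indicator_of_notMem h]
  have hi := fun r => integrable_kernel_smul_cut hβ hp r
  have hj := fun r => integrable_kernel_smul_cut hβ hu r
  have hl : Integrable ((Ioc (t - δ) t).indicator fun s => kernel β (t - s)) := by
    rw [integrable_indicator_iff measurableSet_Ioc,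
      ← intervalIntegrable_iff_integrableOn_Ioc_of_le (by linarith)]
    simpa using (intervalIntegrable_kernel hβ δ 0).comp_sub_left t
  have hl' : ∫ s, (Ioc (t - δ) t).indicator (fun s => kernel β (t - s)) s
      = ∫ s in (0 : ℝ)..δ, kernel β s := by
    rw [integral_indicator measurableSet_Ioc, ← intervalIntegral.integral_of_le (by linarith),
      intervalIntegral.integral_comp_sub_left]
    simp
  have hne : ∀ᵐ s : ℝ, s ≠ t - δ := by simp [ae_iff]
  -- Pointwise bound on three ranges. For s < t - δ the kernel increment is nonpositive and p(s) ≥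
  -- p(t); on (t - δ, t] only the first kernel survives and p(s) ≤ p(t) + c; for s > t both vanish.
  have hmono : ∫ s, (kernel β (t - s) • cut S p s - kernel β (t - δ - s) • cut S p s) ≤
      ∫ s, (p t * (kernel β (t - s) • cut S (fun _ => (1 : ℝ)) s
        - kernel β (t - δ - s) • cut S (fun _ => (1 : ℝ)) s)
        + c * (Ioc (t - δ) t).indicator (fun s => kernel β (t - s)) s) := by
    refine integral_mono_ae ((hi t).sub (hi _))
      ((((hj t).sub (hj _)).const_mul _).add (hl.const_mul c)) ?_
    filter_upwards [hne] with s hs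
    by_cases h : s ∈ Icc 0 S
    · simp only [cut_of_mem _ h, smul_eq_mul, mul_one]
      rcases hs.lt_or_gt with h1 | h1
      · rw [indicator_of_notMem fun h2 => h1.not_gt h2.1]
        have h3 := kernel_le_kernel hβ hβ₁ (show 0 < t - δ - s by linarith)
          (show t - δ - s ≤ t - s by linarith)
        nlinarith [hmin s h]
      · rw [kernel_of_nonpos (show t - δ - s ≤ 0 by linarith)]
        rcases le_or_gt s t with h2 | h2
        · rw [indicator_of_mem (show s ∈ Ioc (t - δ) t from ⟨h1, h2⟩)]
          nlinarith [hc s ⟨h1.le, h2⟩, kernel_nonneg hβ (t - s)]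
        · rw [indicator_of_notMem fun h3 => h2.not_ge h3.2,
            kernel_of_nonpos (show t - s ≤ 0 by linarith)]
          simp
    · have h1 : s ∉ Ioc (t - δ) t := fun h2 => h ⟨by linarith [h2.1], h2.2.trans htS⟩
      simp [cut, indicator_of_notMem h, indicator_of_notMem h1]
  have hadd := integral_add (((hj t).sub (hj (t - δ))).const_mul (p t)) (hl.const_mul c)
  simp only [Pi.sub_apply] at hadd
  rw [integral_sub (hi t) (hi _), hadd,
    integral_const_mul, integral_const_mul, hl', integral_sub (hj t) (hj _),
    hone t htS (by linarith), hone (t - δ) (by linarith) (by linarith)] at hmono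
  simp only [conv, convolution_lsmul_swap]
  -- What remains is p(t) ≤ 0 times a nonnegative increment of the primitive of the kernel, which
  -- may be dropped.
  have hG := integral_kernel_mono hβ (show t - δ ≤ t by linarith)
  nlinarith

/-- Since p'(t) = 0, p ≤ p(t) + δ on [t - δ, t] for small δ. Taking c = δ in `conv_kernel_sub_le`
bounds the backward difference quotient by ∫₀^δ g_β, which tends to 0. H stands for the convolution,
with which it need only agree almost everywhere and at t. -/
theorem nonpos_of_hasDerivAt_conv {β : ℝ} (hβ : 0 < β) (hβ₁ : β ≤ 1) {S t d : ℝ} {p H : ℝ → ℝ}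
    (hp : ContinuousOn p (Icc 0 S)) (ht : 0 < t) (htS : t < S) (hpt : p t ≤ 0)
    (hmin : ∀ s ∈ Icc 0 S, p t ≤ p s) (hpd : HasDerivAt p 0 t) (hH : HasDerivAt H d t)
    (heq : conv (kernel β) (cut S p) t = H t)
    (hae : ∀ᵐ s, 0 < s → s < S → conv (kernel β) (cut S p) s = H s) : d ≤ 0 := by
  have h1 : Tendsto (fun δ : ℝ => δ⁻¹ * (H t - H (t - δ))) (𝓝[>] 0) (𝓝 d) := by
    have h2 := hH.tendsto_slope_zero_left
    have h3 : Tendsto (fun δ : ℝ => -δ) (𝓝[>] 0) (𝓝[<] 0) := by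
      simpa using tendsto_neg_nhdsGT (a := (0 : ℝ))
    refine (h2.comp h3).congr fun δ => ?_
    simp only [Function.comp_apply, smul_eq_mul, inv_neg, ← sub_eq_add_neg]
    ring
  have h2 : Tendsto (fun δ : ℝ => ∫ s in (0 : ℝ)..δ, kernel β s) (𝓝[>] 0) (𝓝 0) := by
    have hc : Continuous fun δ : ℝ => ∫ s in (0 : ℝ)..δ, kernel β s :=
      intervalIntegral.continuous_primitive (fun a b => intervalIntegrable_kernel hβ a b) 0
    have := (hc.tendsto 0).mono_left (nhdsWithin_le_nhds (s := Ioi 0))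
    simpa using this
  have h3 : ∀ᶠ δ in 𝓝[>] (0 : ℝ), ∀ s ∈ Icc (t - δ) t, p s ≤ p t + δ := by
    have h4 := hpd.isLittleO.def one_pos
    obtain ⟨r, hr, hball⟩ := Metric.eventually_nhds_iff.1 h4
    filter_upwards [Ioo_mem_nhdsGT hr] with δ hδ s hs
    have h5 : |s - t| ≤ δ := by
      rw [abs_le]
      exact ⟨by linarith [hs.1], by linarith [hs.2, hδ.1]⟩
    have h6 := hball (show dist s t < r from lt_of_le_of_lt h5 hδ.2)
    simp only [smul_zero, sub_zero, one_mul, Real.norm_eq_abs] at h6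
    linarith [le_abs_self (p s - p t)]
  have h4 : ∀ᵐ δ : ℝ, 0 < t - δ → t - δ < S → conv (kernel β) (cut S p) (t - δ) = H (t - δ) :=
    (quasiMeasurePreserving_sub_left_of_right_invariant volume t).ae hae
  refine le_of_tendsto_of_tendsto_of_frequently h1 h2 ?_
  refine ((frequently_nhdsGT_of_ae h4 0).and_eventually (h3.and (Ioo_mem_nhdsGT ht))).mono ?_
  rintro δ ⟨h5, h6, hδ⟩
  have h7 := conv_kernel_sub_le hβ hβ₁ hp hδ.1 hδ.2.le htS.le hpt hmin h6
  rw [heq, h5 (by linarith [hδ.2]) (by linarith [hδ.1])] at h7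
  rw [inv_mul_le_iff₀ hδ.1]
  exact h7

theorem add_fderiv_le_of_convexOn {E : F → ℝ} (hE : ConvexOn ℝ univ E) {y z : F}
    (hd : DifferentiableAt ℝ E z) : E z + fderiv ℝ E z (y - z) ≤ E y := by
  have h1 : ConvexOn ℝ univ fun r : ℝ => E (AffineMap.lineMap z y r) :=
    hE.comp_affineMap (AffineMap.lineMap z y)
  have h2 : HasDerivAt (fun r : ℝ => E (AffineMap.lineMap z y r)) (fderiv ℝ E z (y - z)) 0 := by
    have h3 : HasFDerivAt E (fderiv ℝ E z) (AffineMap.lineMap z y (0 : ℝ)) := by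
      simpa using hd.hasFDerivAt
    exact h3.comp_hasDerivAt 0 AffineMap.hasDerivAt_lineMap
  have h3 := h1.le_slope_of_hasDerivAt (mem_univ 0) (mem_univ 1) one_pos h2
  simp only [slope_def_field, AffineMap.lineMap_apply_one, AffineMap.lineMap_apply_zero] at h3
  linarith

/-- The Caputo derivative of a convex function of a smooth curve, `D E(x) ≤ E'(x) D x`. -/
theorem caputo_convex_le [CompleteSpace F] {β : ℝ} (hβ : 0 < β) (hβ₁ : β ≤ 1) {S : ℝ} {E : F → ℝ}
    (hE : ConvexOn ℝ univ E) (hEd : Differentiable ℝ E) {x f : ℝ → F} {g : ℝ → ℝ}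
    (hx : Differentiable ℝ x) (hf : IntegrableOn f (Icc 0 S)) (hg : IntegrableOn g (Icc 0 S))
    (hxf : ∀ᵐ t, t < S → conv (kernel β) (cut S fun s => x s - x 0) t
      = conv (kernel 1) (cut S f) t)
    (hEg : ∀ᵐ t, t < S → conv (kernel β) (cut S fun s => E (x s) - E (x 0)) t
      = conv (kernel 1) (cut S g) t) :
    ∀ᵐ t, t ∈ Ioo 0 S → g t ≤ fderiv ℝ E (x t) (f t) := by
  have hxc : ContinuousOn (fun s => x s - x 0) (Icc 0 S) :=
    (hx.continuous.sub continuous_const).continuousOn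
  have hEc : ContinuousOn (fun s => E (x s) - E (x 0)) (Icc 0 S) :=
    ((hEd.continuous.comp hx.continuous).sub continuous_const).continuousOn
  filter_upwards [hxf, hEg, _root_.LocallyIntegrable.ae_hasDerivAt_integral
    (integrable_cut hf).locallyIntegrable, _root_.LocallyIntegrable.ae_hasDerivAt_integral
    (integrable_cut hg).locallyIntegrable] with t h1 h2 h3 h4 ht
  set A := fderiv ℝ E (x t)
  -- E along the curve minus its tangent at x(t), normalised by p(0) = 0. Convexity makes t a
  -- minimum, hence p(t) ≤ p(0) = 0.
  set p : ℝ → ℝ := fun s => (E (x s) - E (x 0)) - A (x s - x 0) with hp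
  set H : ℝ → ℝ := fun r => (∫ s in (0 : ℝ)..r, cut S g s) - A (∫ s in (0 : ℝ)..r, cut S f s)
  have hconv : ∀ r, conv (kernel β) (cut S p) r =
      conv (kernel β) (cut S fun s => E (x s) - E (x 0)) r
      - A (conv (kernel β) (cut S fun s => x s - x 0) r) := by
    intro r
    simp only [conv, convolution_lsmul_swap]
    rw [← ContinuousLinearMap.integral_comp_comm A (integrable_kernel_smul_cut hβ hxc r),
      ← integral_sub (integrable_kernel_smul_cut hβ hEc r)
        (A.integrable_comp (integrable_kernel_smul_cut hβ hxc r))]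
    congr 1
    ext s
    by_cases h : s ∈ Icc 0 S
    · simp only [cut_of_mem _ h, hp, map_smul, smul_sub (kernel β (r - s)) (E (x s) - E (x 0))]
    · simp [cut, indicator_of_notMem h]
  have hH : ∀ r, 0 ≤ r → conv (kernel 1) (cut S g) r - A (conv (kernel 1) (cut S f) r) = H r := by
    intro r hr
    rw [conv_kernel_one (fun s hs => cut_of_neg _ hs) hr,
      conv_kernel_one (fun s hs => cut_of_neg _ hs) hr]
  have hpd : HasDerivAt p 0 t := by
    have e1 : HasDerivAt x (deriv x t) t := (hx t).hasDerivAt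
    have e2 := ((hEd (x t)).hasFDerivAt.comp_hasDerivAt t e1).sub_const (E (x 0))
    have e3 := (A.hasFDerivAt (x := x t - x 0)).comp_hasDerivAt t (e1.sub_const (x 0))
    have e4 := e2.sub e3
    rw [sub_self] at e4
    exact e4
  have hHd : HasDerivAt H (cut S g t - A (cut S f t)) t :=
    (h4 0).sub (A.hasFDerivAt.comp_hasDerivAt t (h3 0))
  have hmin : ∀ s ∈ Icc 0 S, p t ≤ p s := by
    intro s _
    have := add_fderiv_le_of_convexOn hE (y := x s) (hEd (x t))
    have e : A (x s - x t) = A (x s - x 0) - A (x t - x 0) := by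
      rw [← map_sub]
      congr 1
      abel
    simp only [hp]
    change E (x t) + A (x s - x t) ≤ _ at this
    linarith
  have hpt : p t ≤ 0 := by
    have := hmin 0 ⟨le_rfl, (ht.1.trans ht.2).le⟩
    simpa [hp] using this
  have hpc : ContinuousOn p (Icc 0 S) := hEc.sub (A.continuous.comp_continuousOn hxc)
  have := nonpos_of_hasDerivAt_conv hβ hβ₁ hpc ht.1 ht.2 hpt hmin hpd hHd
    (by rw [hconv, h1 ht.2, h2 ht.2, hH t ht.1.le]) (by
      filter_upwards [hxf, hEg] with r e1 e2 h0 hr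
      rw [hconv, e1 hr, e2 hr, hH r h0.le])
  rw [cut_of_mem _ ⟨ht.1.le, ht.2.le⟩, cut_of_mem _ ⟨ht.1.le, ht.2.le⟩] at this
  linarith

/-! ### Averaged initial values -/

theorem hasInitialValue_congr {φ ψ : ℝ → G} {C : G} {r : ℝ} (hr : 0 < r)
    (h : ∀ t ∈ Ioo 0 r, φ t = ψ t) (hφ : HasInitialValue φ C) : HasInitialValue ψ C := by
  refine Tendsto.congr' ?_ hφ
  filter_upwards [Ioo_mem_nhdsGT hr] with t ht
  congr 1
  rw [intervalIntegral.integral_of_le ht.1.le, intervalIntegral.integral_of_le ht.1.le]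
  refine setIntegral_congr_fun measurableSet_Ioc fun s hs => ?_
  simp only [h s ⟨hs.1, hs.2.trans_lt ht.2⟩]

theorem hasInitialValue_of_continuous {x : ℝ → G} (hx : Continuous x) :
    HasInitialValue x (x 0) := by
  have hc : Continuous fun s => ‖x s - x 0‖ := (hx.sub continuous_const).norm
  have h1 : HasDerivAt (fun t => ∫ s in (0 : ℝ)..t, ‖x s - x 0‖) (‖x 0 - x 0‖) 0 :=
    intervalIntegral.integral_hasDerivAt_right (hc.intervalIntegrable _ _)
      (hc.stronglyMeasurableAtFilter _ _) hc.continuousAt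
  have h2 := h1.tendsto_slope_zero_right
  simpa [HasInitialValue] using h2

theorem HasInitialValue.unique {φ : ℝ → G} {C C' : G} {r : ℝ} (hr : 0 < r)
    (hφ : IntegrableOn φ (Icc 0 r)) (h : HasInitialValue φ C) (h' : HasInitialValue φ C') :
    C = C' := by
  have h1 : ∀ᶠ t : ℝ in 𝓝[>] 0, ‖C - C'‖ ≤ t⁻¹ * (∫ s in (0 : ℝ)..t, ‖φ s - C‖)
      + t⁻¹ * ∫ s in (0 : ℝ)..t, ‖φ s - C'‖ := by
    filter_upwards [Ioo_mem_nhdsGT hr] with t ht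
    have hi : ∀ c : G, IntervalIntegrable (fun s => ‖φ s - c‖) volume 0 t := by
      intro c
      have : IntegrableOn φ (Icc 0 t) := hφ.mono_set (Icc_subset_Icc_right ht.2.le)
      rw [← intervalIntegrable_iff_integrableOn_Icc_of_le ht.1.le] at this
      exact (this.sub intervalIntegrable_const).norm
    rw [← mul_add, ← intervalIntegral.integral_add (hi C) (hi C'), ← div_eq_inv_mul,
      le_div_iff₀ ht.1]
    have h2 : ∫ s in (0 : ℝ)..t, ‖C - C'‖ = ‖C - C'‖ * t := by simp [mul_comm]
    rw [← h2]
    refine intervalIntegral.integral_mono_on ht.1.le intervalIntegrable_const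
      ((hi C).add (hi C')) fun s _ => ?_
    rw [norm_sub_rev (φ s) C]
    simpa using norm_sub_le_norm_sub_add_norm_sub C (φ s) C'
  have h2 : Tendsto (fun t : ℝ => t⁻¹ * (∫ s in (0 : ℝ)..t, ‖φ s - C‖)
      + t⁻¹ * ∫ s in (0 : ℝ)..t, ‖φ s - C'‖) (𝓝[>] 0) (𝓝 (0 + 0)) := h.add h'
  have h3 := ge_of_tendsto h2 h1
  rw [add_zero] at h3
  exact sub_eq_zero.1 (norm_le_zero_iff.1 h3)

theorem initialValue_eq {φ : ℝ → G} {C : G} {r : ℝ} (hr : 0 < r)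
    (hφ : IntegrableOn φ (Icc 0 r)) (h : HasInitialValue φ C) : initialValue φ = C := by
  have h1 : ∃ C : G, HasInitialValue φ C := ⟨C, h⟩
  rw [initialValue, dif_pos h1]
  exact h1.choose_spec.unique hr hφ h

theorem hasInitialValue_initialValue {φ : ℝ → G} (h : ∃ C : G, HasInitialValue φ C) :
    HasInitialValue φ (initialValue φ) := by
  rw [initialValue, dif_pos h]
  exact h.choose_spec

/-! ### One-sided mollification -/

/-- The rescaled mollifier `η_ε(t) = ε⁻¹ η(t / ε)`. -/
def scaled (η : ℝ → ℝ) (ε : ℝ) : ℝ → ℝ := fun t => ε⁻¹ * η (t / ε)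

theorem mollify_eq_conv (η : ℝ → ℝ) (ε : ℝ) (φ : ℝ → F) :
    mollify η ε φ = conv (scaled η ε) φ := rfl

namespace IsMollifier

variable {η : ℝ → ℝ} {ε : ℝ}

theorem exists_support_bound (hη : IsMollifier η) :
    ∃ M : ℝ, 0 < M ∧ ∀ ε : ℝ, 0 < ε → ∀ s ∉ Ioo (-(ε * M)) 0, scaled η ε s = 0 := by
  obtain ⟨M, hM0, hM⟩ := hη.hasCompactSupport.isCompact.isBounded.subset_ball_lt 0 0
  refine ⟨M, hM0, fun ε hε s hs => ?_⟩
  rw [scaled, mul_eq_zero]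
  right
  by_contra h
  have h1 := subset_tsupport η h
  have h2 : s / ε < 0 := hη.tsupport_subset h1
  have h3 := hM h1
  rw [Real.ball_eq_Ioo] at h3
  refine hs ⟨?_, ?_⟩
  · have := (lt_div_iff₀ hε).1 h3.1
    linarith
  · have := (div_lt_iff₀ hε).1 h2
    linarith

theorem contDiff_scaled (hη : IsMollifier η) (ε : ℝ) : ContDiff ℝ ∞ (scaled η ε) :=
  contDiff_const.mul (hη.smooth.comp (contDiff_id.div_const ε))

theorem hasCompactSupport_scaled (hη : IsMollifier η) (hε : 0 < ε) :
    HasCompactSupport (scaled η ε) := by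
  obtain ⟨M, _, hM⟩ := hη.exists_support_bound
  exact HasCompactSupport.intro isCompact_Icc
    fun s hs => hM ε hε s fun h => hs (Ioo_subset_Icc_self h)

theorem scaled_nonneg (hη : IsMollifier η) (hε : 0 < ε) (s : ℝ) : 0 ≤ scaled η ε s :=
  mul_nonneg (inv_nonneg.2 hε.le) (hη.nonneg _)

theorem integrable_scaled (hη : IsMollifier η) (hε : 0 < ε) : Integrable (scaled η ε) :=
  (hη.contDiff_scaled ε).continuous.integrable_of_hasCompactSupport (hη.hasCompactSupport_scaled hε)

theorem integral_scaled (hη : IsMollifier η) (hε : 0 < ε) : ∫ s, scaled η ε s = 1 := by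
  simp only [scaled]
  rw [integral_const_mul, Measure.integral_comp_div, hη.integral_eq_one, abs_of_pos hε]
  simp [hε.ne']

theorem integral_norm_scaled (hη : IsMollifier η) (hε : 0 < ε) : ∫ s, ‖scaled η ε s‖ = 1 := by
  simp_rw [Real.norm_of_nonneg (hη.scaled_nonneg hε _)]
  exact hη.integral_scaled hε

theorem contDiff_mollify (hη : IsMollifier η) (hε : 0 < ε) {φ : ℝ → F} [CompleteSpace F]
    (hφ : Integrable φ) : ContDiff ℝ ∞ (mollify η ε φ) :=
  (hη.hasCompactSupport_scaled hε).contDiff_convolution_left _ (hη.contDiff_scaled ε)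
    hφ.locallyIntegrable

theorem integrable_scaled_smul (hη : IsMollifier η) (hε : 0 < ε) {φ : ℝ → F}
    (hφ : Integrable φ) (t : ℝ) : Integrable fun s => scaled η ε s • φ (t - s) :=
  (hφ.comp_sub_left t).smul_of_top_right
    ((hη.contDiff_scaled ε).continuous.memLp_top_of_hasCompactSupport
      (hη.hasCompactSupport_scaled hε) _)

theorem norm_mollify_sub_le (hη : IsMollifier η) (hε : 0 < ε) {φ : ℝ → F} [CompleteSpace F]
    (hφ : Integrable φ) (t : ℝ) (C : F) :
    ‖mollify η ε φ t - C‖ ≤ ∫ s, scaled η ε s * ‖φ (t - s) - C‖ := by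
  have h1 : mollify η ε φ t - C = ∫ s, scaled η ε s • (φ (t - s) - C) := by
    simp_rw [smul_sub]
    rw [integral_sub (hη.integrable_scaled_smul hε hφ t)
      ((hη.integrable_scaled hε).smul_const C), integral_smul_const, hη.integral_scaled hε,
      one_smul]
    rfl
  rw [h1]
  refine (norm_integral_le_integral_norm _).trans_eq ?_
  simp_rw [norm_smul, Real.norm_of_nonneg (hη.scaled_nonneg hε _)]

/-- Only values on a short interval to the right of t matter, so v may be truncated before
mollifying. -/
theorem mollify_congr {M : ℝ}
    (hM : ∀ ε : ℝ, 0 < ε → ∀ s ∉ Ioo (-(ε * M)) 0, scaled η ε s = 0) (hε : 0 < ε)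
    {φ ψ : ℝ → F} {t : ℝ} (h : ∀ s ∈ Icc t (t + ε * M), φ s = ψ s) :
    mollify η ε φ t = mollify η ε ψ t := by
  simp only [mollify_eq_conv, conv, convolution_lsmul]
  congr 1
  ext s
  by_cases hs : s ∈ Ioo (-(ε * M)) 0
  · rw [h (t - s) ⟨by linarith [hs.2], by linarith [hs.1]⟩]
  · rw [hM ε hε s hs, zero_smul, zero_smul]

/-- As η ≤ 1, the weight is at most 1/ε = M · (εM)⁻¹ on an interval of length εM, so the error is at
most M times the mean that defines the initial value. -/
theorem tendsto_mollify_zero (hη : IsMollifier η) {ε : ℕ → ℝ} (hε : ∀ k, 0 < ε k)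
    (hε₀ : Tendsto ε atTop (𝓝 0)) {φ : ℝ → F} [CompleteSpace F] (hφ : Integrable φ) {C : F}
    (hC : HasInitialValue φ C) : Tendsto (fun k => mollify η (ε k) φ 0) atTop (𝓝 C) := by
  obtain ⟨M, hM0, hM⟩ := hη.exists_support_bound
  have h1 : Tendsto (fun k => ε k * M) atTop (𝓝[>] 0) := by
    refine tendsto_nhdsWithin_iff.2 ⟨by simpa using hε₀.mul_const M,
      Eventually.of_forall fun k => mul_pos (hε k) hM0⟩
  have h2 := (hC.comp h1).const_mul M
  rw [mul_zero] at h2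
  rw [tendsto_iff_norm_sub_tendsto_zero]
  refine squeeze_zero (fun _ => norm_nonneg _) (fun k => ?_) h2
  refine (hη.norm_mollify_sub_le (hε k) hφ 0 C).trans ?_
  have hpos := mul_pos (hε k) hM0
  have hint : IntervalIntegrable (fun s => ‖φ s - C‖) volume 0 (ε k * M) :=
    (hφ.intervalIntegrable.sub intervalIntegrable_const).norm
  have h3 : ∫ s in Ioc (-(ε k * M)) 0, (ε k)⁻¹ * ‖φ (-s) - C‖
      = M * ((ε k * M)⁻¹ * ∫ s in (0 : ℝ)..(ε k * M), ‖φ s - C‖) := by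
    rw [integral_const_mul, ← intervalIntegral.integral_of_le (by linarith),
      intervalIntegral.integral_comp_neg fun s => ‖φ s - C‖]
    rw [neg_zero, neg_neg]
    have := (hε k).ne'
    field_simp
  rw [Function.comp_apply, ← h3, ← integral_indicator measurableSet_Ioc]
  refine integral_mono_of_nonneg (Eventually.of_forall fun s =>
    mul_nonneg (hη.scaled_nonneg (hε k) s) (norm_nonneg _)) ?_ (Eventually.of_forall fun s => ?_)
  · rw [integrable_indicator_iff measurableSet_Ioc,
      ← intervalIntegrable_iff_integrableOn_Ioc_of_le (by linarith)]
    have h4 := hint.symm.comp_sub_left 0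
    simp only [zero_sub, neg_zero] at h4
    exact h4.const_mul _
  · simp only [zero_sub]
    by_cases hs : s ∈ Ioo (-(ε k * M)) 0
    · rw [indicator_of_mem (Ioo_subset_Ioc_self hs)]
      refine mul_le_mul_of_nonneg_right ?_ (norm_nonneg _)
      exact (mul_le_mul_of_nonneg_left (hη.le_one _) (inv_nonneg.2 (hε k).le)).trans_eq (mul_one _)
    · rw [hM _ (hε k) s hs, zero_mul]
      exact indicator_nonneg (fun r _ => mul_nonneg (inv_nonneg.2 (hε k).le) (norm_nonneg _)) _

theorem tendsto_integral_norm_mollify_sub_of_continuous (hη : IsMollifier η) {ε : ℕ → ℝ}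
    (hε : ∀ k, 0 < ε k) (hε₀ : Tendsto ε atTop (𝓝 0)) {φ : ℝ → F} [CompleteSpace F]
    (hφ : Continuous φ) (hc : HasCompactSupport φ) :
    Tendsto (fun k => ∫ t, ‖mollify η (ε k) φ t - φ t‖) atTop (𝓝 0) := by
  obtain ⟨M, hM0, hM⟩ := hη.exists_support_bound
  have hφi : Integrable φ := hφ.integrable_of_hasCompactSupport hc
  have hu : UniformContinuous φ := hc.uniformContinuous_of_continuous hφ
  obtain ⟨R, hR0, hR⟩ := hc.isCompact.isBounded.subset_closedBall_lt 0 0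
  have hφ0 : ∀ t, R < |t| → φ t = 0 := fun t ht => by
    by_contra h
    have := hR (subset_tsupport φ h)
    rw [mem_closedBall_zero_iff, Real.norm_eq_abs] at this
    linarith
  rw [Metric.tendsto_atTop]
  intro e he
  -- The error is at most κ and, once εM < 1, supported in [-(R + 1), R + 1], so it integrates to at
  -- most e / 2.
  set κ := e / (2 * (2 * (R + 1))) with hκ
  have hκ0 : 0 < κ := by positivity
  obtain ⟨d, hd, hdu⟩ := Metric.uniformContinuous_iff.1 hu κ hκ0
  have hev : ∀ᶠ k in atTop, ε k * M < min d 1 := by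
    have : Tendsto (fun k => ε k * M) atTop (𝓝 0) := by simpa using hε₀.mul_const M
    exact this.eventually_lt_const (lt_min hd one_pos)
  obtain ⟨N, hN⟩ := eventually_atTop.1 hev
  refine ⟨N, fun k hk => ?_⟩
  have hkd := (hN k hk).trans_le (min_le_left _ _)
  have hk1 := (hN k hk).trans_le (min_le_right _ _)
  have hbound : ∀ t, ‖mollify η (ε k) φ t - φ t‖ ≤
      (Icc (-(R + 1)) (R + 1)).indicator (fun _ => κ) t := by
    intro t
    by_cases ht : t ∈ Icc (-(R + 1)) (R + 1)
    · rw [indicator_of_mem ht]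
      refine (hη.norm_mollify_sub_le (hε k) hφi t (φ t)).trans ?_
      have : ∫ s, scaled η (ε k) s * κ = κ := by
        rw [integral_mul_const, hη.integral_scaled (hε k), one_mul]
      rw [← this]
      refine integral_mono_of_nonneg (Eventually.of_forall fun s =>
        mul_nonneg (hη.scaled_nonneg (hε k) s) (norm_nonneg _))
        ((hη.integrable_scaled (hε k)).mul_const κ) (Eventually.of_forall fun s => ?_)
      by_cases hs : s ∈ Ioo (-(ε k * M)) 0
      · refine mul_le_mul_of_nonneg_left ?_ (hη.scaled_nonneg (hε k) s)
        rw [← dist_eq_norm]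
        refine (hdu ?_).le
        rw [Real.dist_eq, sub_sub_cancel_left, abs_neg, abs_of_neg hs.2]
        linarith [hs.1]
      · simp [hM _ (hε k) s hs]
    · rw [indicator_of_notMem ht]
      have ht' : R + 1 < |t| := by
        by_contra h
        exact ht (abs_le.1 (not_lt.1 h))
      rw [hφ0 t (by linarith), sub_zero, mollify_eq_conv, conv, convolution_lsmul,
        integral_eq_zero_of_ae, norm_zero]
      refine Eventually.of_forall fun s => ?_
      by_cases hs : s ∈ Ioo (-(ε k * M)) 0
      · have h1 : |s| < 1 := by
          rw [abs_of_neg hs.2]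
          linarith [hs.1]
        have h2 := abs_sub_abs_le_abs_sub t s
        simp [hφ0 (t - s) (by linarith)]
      · simp [hM _ (hε k) s hs]
  have hint : ∫ t, ‖mollify η (ε k) φ t - φ t‖ ≤ 2 * (R + 1) * κ := by
    refine (integral_mono_of_nonneg (Eventually.of_forall fun _ => norm_nonneg _)
      ((integrable_indicator_iff measurableSet_Icc).2 (integrableOn_const (by simp)))
      (Eventually.of_forall hbound)).trans_eq ?_
    rw [integral_indicator measurableSet_Icc, setIntegral_const, Measure.real, Real.volume_Icc,
      ENNReal.toReal_ofReal (by linarith), smul_eq_mul]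
    ring
  have : 2 * (R + 1) * κ = e / 2 := by
    rw [hκ]
    field_simp
  rw [Real.dist_eq, sub_zero, abs_of_nonneg (integral_nonneg fun _ => norm_nonneg _)]
  linarith

/-- Mollification is an L¹ contraction, so density of compactly supported continuous functions
reduces this to the previous case, with three errors of size e / 4. -/
theorem tendsto_integral_norm_mollify_sub (hη : IsMollifier η) {ε : ℕ → ℝ}
    (hε : ∀ k, 0 < ε k) (hε₀ : Tendsto ε atTop (𝓝 0)) {φ : ℝ → F} [CompleteSpace F]
    (hφ : Integrable φ) :
    Tendsto (fun k => ∫ t, ‖mollify η (ε k) φ t - φ t‖) atTop (𝓝 0) := by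
  rw [Metric.tendsto_atTop]
  intro e he
  obtain ⟨c, hcs, hce, hcc, hci⟩ := hφ.exists_hasCompactSupport_integral_sub_le
    (show 0 < e / 4 by linarith)
  obtain ⟨N, hN⟩ := Metric.tendsto_atTop.1
    (hη.tendsto_integral_norm_mollify_sub_of_continuous hε hε₀ hcc hcs) (e / 4) (by linarith)
  refine ⟨N, fun k hk => ?_⟩
  have h1 := hN k hk
  rw [Real.dist_eq, sub_zero, abs_of_nonneg (integral_nonneg fun _ => norm_nonneg _)] at h1 ⊢
  have hs := hη.integrable_scaled (hε k)
  have h2 := integral_norm_conv_le hs (hφ.sub hci)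
  rw [hη.integral_norm_scaled (hε k), one_mul] at h2
  simp only [Pi.sub_apply] at h2
  have hmc : Integrable (mollify η (ε k) c) := integrable_conv hs hci
  have h3 : ∫ t, ‖mollify η (ε k) φ t - φ t‖ ≤ ∫ t, (‖conv (scaled η (ε k)) (φ - c) t‖
      + ‖mollify η (ε k) c t - c t‖ + ‖φ t - c t‖) := by
    refine integral_mono_of_nonneg (Eventually.of_forall fun _ => norm_nonneg _)
      (((integrable_conv hs (hφ.sub hci)).norm.add (hmc.sub hci).norm).add (hφ.sub hci).norm) ?_
    filter_upwards [conv_sub hs hφ hci] with t ht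
    change conv (scaled η (ε k)) (φ - c) t = _ at ht
    rw [ht]
    have e1 : mollify η (ε k) φ t - φ t = (conv (scaled η (ε k)) φ t - conv (scaled η (ε k)) c t)
        + (mollify η (ε k) c t - c t) - (φ t - c t) := by
      simp only [mollify_eq_conv]
      abel
    rw [e1]
    exact (norm_sub_le _ _).trans (add_le_add_left (norm_add_le _ _) _)
  have e2 := integral_add ((integrable_conv hs (hφ.sub hci)).norm.add (hmc.sub hci).norm)
    (hφ.sub hci).norm
  have e3 := integral_add (integrable_conv hs (hφ.sub hci)).norm (hmc.sub hci).norm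
  simp only [Pi.add_apply, Pi.sub_apply] at e2 e3
  rw [e2, e3] at h3
  linarith

end IsMollifier

/-! ### Limits in L¹ -/

/-- A sequence converging in `L¹` has a subsequence converging almost everywhere. -/
theorem exists_seq_tendsto_ae_of_integral {α : Type*} [MeasurableSpace α] {μ : Measure α}
    {f : ℕ → α → G} {g : α → G}
    (hf : ∀ᶠ k in atTop, Integrable (f k) μ) (hg : Integrable g μ)
    (h : Tendsto (fun k => ∫ t, ‖f k t - g t‖ ∂μ) atTop (𝓝 0)) :
    ∃ n : ℕ → ℕ, StrictMono n ∧ ∀ᵐ t ∂μ, Tendsto (fun k => f (n k) t) atTop (𝓝 (g t)) := by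
  obtain ⟨N, hN⟩ := eventually_atTop.1 hf
  have hN' : ∀ k, Integrable (f (k + N)) μ := fun k => hN _ (Nat.le_add_left _ _)
  have h1 : Tendsto (fun k => eLpNorm (f (k + N) - g) 1 μ) atTop (𝓝 0) := by
    have h2 := (ENNReal.tendsto_ofReal (h.comp (tendsto_add_atTop_nat N)))
    rw [ENNReal.ofReal_zero] at h2
    refine h2.congr fun k => ?_
    rw [eLpNorm_one_eq_lintegral_enorm]
    exact ofReal_integral_norm_eq_lintegral_enorm ((hN' k).sub hg)
  obtain ⟨n, hn, hae⟩ := (tendstoInMeasure_of_tendsto_eLpNorm one_ne_zero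
    (fun k => (hN' k).aestronglyMeasurable) hg.aestronglyMeasurable h1).exists_seq_tendsto_ae
  exact ⟨fun k => n k + N, fun a b hab => Nat.add_lt_add_right (hn hab) N, hae⟩

theorem tendsto_integral_norm_conv_sub {a : ℝ → ℝ} (ha : Integrable a) {f : ℕ → ℝ → F}
    {g : ℝ → F} (hf : ∀ᶠ k in atTop, Integrable (f k)) (hg : Integrable g)
    (h : Tendsto (fun k => ∫ t, ‖f k t - g t‖) atTop (𝓝 0)) :
    Tendsto (fun k => ∫ t, ‖conv a (f k) t - conv a g t‖) atTop (𝓝 0) := by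
  have h1 := h.const_mul (∫ t, ‖a t‖)
  rw [mul_zero] at h1
  refine squeeze_zero' (Eventually.of_forall fun _ => integral_nonneg fun _ => norm_nonneg _) ?_ h1
  filter_upwards [hf] with k hk
  refine le_trans (le_of_eq ?_) (integral_norm_conv_le ha (hk.sub hg))
  refine integral_congr_ae ?_
  filter_upwards [conv_sub ha hk hg] with t ht
  rw [← ht]

theorem cut_congr {S : ℝ} {φ ψ : ℝ → G} (h : ∀ t ∈ Icc 0 S, φ t = ψ t) : cut S φ = cut S ψ :=
  indicator_congr h

theorem integral_norm_cut_sub_le {S R : ℝ} (hS : 0 ≤ S) (hSR : S ≤ R) {f g : ℝ → G}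
    (hf : IntegrableOn f (Icc 0 R)) (hg : IntegrableOn g (Icc 0 R)) :
    ∫ t, ‖cut S f t - cut S g t‖ ≤ ∫ t in (0 : ℝ)..R, ‖f t - g t‖ := by
  have h1 : (fun t => ‖cut S f t - cut S g t‖) = (Icc 0 S).indicator fun t => ‖f t - g t‖ := by
    ext t
    by_cases h : t ∈ Icc 0 S
    · rw [cut_of_mem _ h, cut_of_mem _ h, indicator_of_mem h]
    · simp [cut, indicator_of_notMem h]
  rw [h1, integral_indicator measurableSet_Icc, intervalIntegral.integral_of_le (hS.trans hSR),
    ← integral_Icc_eq_integral_Ioc]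
  exact setIntegral_mono_set (hf.sub hg).norm (Eventually.of_forall fun _ => norm_nonneg _)
    (Icc_subset_Icc_right hSR).eventuallyLE

/-- Along a common subsequence both sides converge almost everywhere, so the equality survives. -/
theorem ae_eq_of_tendsto_integral {f g : ℕ → ℝ → G} {f' g' : ℝ → G} {S : ℝ}
    (hfi : ∀ᶠ k in atTop, Integrable (f k)) (hfi' : Integrable f')
    (hgi : ∀ᶠ k in atTop, Integrable (g k)) (hgi' : Integrable g')
    (hf : Tendsto (fun k => ∫ t, ‖f k t - f' t‖) atTop (𝓝 0))
    (hg : Tendsto (fun k => ∫ t, ‖g k t - g' t‖) atTop (𝓝 0))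
    (h : ∀ᶠ k in atTop, ∀ᵐ t, t < S → f k t = g k t) : ∀ᵐ t, t < S → f' t = g' t := by
  obtain ⟨n, hn, h1⟩ := exists_seq_tendsto_ae_of_integral hfi hfi' hf
  obtain ⟨m, hm, h2⟩ := exists_seq_tendsto_ae_of_integral (hn.tendsto_atTop.eventually hgi) hgi'
    (hg.comp hn.tendsto_atTop)
  obtain ⟨N, hN⟩ := eventually_atTop.1 ((hn.tendsto_atTop.comp hm.tendsto_atTop).eventually h)
  have h3 : ∀ᵐ t, ∀ k, t < S → f (n (m (k + N))) t = g (n (m (k + N))) t :=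
    ae_all_iff.2 fun k => hN (k + N) (Nat.le_add_left _ _)
  filter_upwards [h1, h2, h3] with t e1 e2 e3 hS
  have e4 := (e1.comp hm.tendsto_atTop).comp (tendsto_add_atTop_nat N)
  have e5 := e2.comp (tendsto_add_atTop_nat N)
  exact tendsto_nhds_unique (e4.congr fun k => e3 k hS) e5

/-! ### The energy inequality on compact intervals -/

/-- The integrated Caputo equation for a function which is continuous on `[0, R]`. -/
theorem caputo_integrated_of_continuous [CompleteSpace F] {γ : ℝ} (hγ₁ : γ < 1) {S R : ℝ}
    (hS : 0 < S) (hSR : S < R) {ψ y f : ℝ → F} (hψ : MemX (R : EReal) ψ)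
    (hf : IntegrableOn f (Icc 0 R)) (h : caputo γ (R : EReal) ψ = ofFun (R : EReal) (causal f))
    (hy : Continuous y) (hψy : ∀ t ∈ Icc 0 R, ψ t = y t) :
    ∀ᵐ t, t < S → conv (kernel (1 - γ)) (cut S fun s => y s - y 0) t =
      conv (kernel 1) (cut S f) t := by
  have hSR' : (S : EReal) < (R : EReal) := EReal.coe_lt_coe_iff.2 hSR
  have hf' : LocallyIntegrableOn f (timeInterval (R : EReal)) :=
    (hf.mono_set fun t ht => ⟨ht.1, (EReal.coe_lt_coe_iff.1 ht.2).le⟩).locallyIntegrableOn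
  have h0 : initialValue ψ = y 0 :=
    initialValue_eq hS (integrableOn_Icc_of_timeInterval hψ.1 hSR')
      (hasInitialValue_congr (hS.trans hSR) (fun t ht => (hψy t (Ioo_subset_Icc_self ht)).symm)
        (hasInitialValue_of_continuous hy))
  have h1 := caputo_integrated hγ₁ hψ.1 hf' h hS hSR'
  rwa [h0, cut_congr (ψ := fun s => y s - y 0)
    fun t ht => by rw [hψy t (Icc_subset_Icc_right hSR.le ht)]] at h1

theorem conv_kernel_nonpos {β : ℝ} (hβ : 0 < β) {φ : ℝ → ℝ} (h : ∀ᵐ s, φ s ≤ 0) (t : ℝ) :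
    conv (kernel β) φ t ≤ 0 := by
  rw [conv, convolution_lsmul_swap]
  refine integral_nonpos_of_ae ?_
  filter_upwards [h] with s hs
  exact mul_nonpos_of_nonneg_of_nonpos (kernel_nonneg hβ _) hs

/-- Only E'(x) f(x) ≤ 0 is needed of the right-hand side, which covers gradient flows and skew flows
together. -/
theorem energy_le_of_lt [CompleteSpace F] {γ : ℝ} (hγ₀ : 0 < γ) (hγ₁ : γ < 1) {E : F → ℝ}
    (hE : ContDiff ℝ 1 E) (hconv : ConvexOn ℝ univ E) {T : EReal} {v : ℝ → F} {f : F → F}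
    (hsol : IsSolution γ T f v) (hf : ∀ x, fderiv ℝ E x (f x) ≤ 0)
    {η : ℝ → ℝ} (hη : IsMollifier η) {ε : ℕ → ℝ} (hε : ∀ k, 0 < ε k)
    (hε₀ : Tendsto ε atTop (𝓝 0))
    (hconvE : CaputoConvergesL1loc γ T fun k t => E (mollify η (ε k) v t))
    (hconvv : CaputoConvergesL1loc γ T fun k => mollify η (ε k) v)
    {S : ℝ} (hS : 0 < S) (hST : (S : EReal) < T) :
    ∀ᵐ t, t ∈ Ioo 0 S → E (v t) ≤ E (initialValue v) := by
  -- Room for two losses, S < S₁ < S₂ < T: v is truncated at S₂, its mollification is correct on [0,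
  -- S₁] for small ε, and the integrated equations hold up to S.
  obtain ⟨S₁, hS₁, hS₁T⟩ := EReal.lt_iff_exists_real_btwn.1 hST
  obtain ⟨S₂, hS₂, hS₂T⟩ := EReal.lt_iff_exists_real_btwn.1 hS₁T
  rw [EReal.coe_lt_coe_iff] at hS₁ hS₂
  have hS₁0 : 0 < S₁ := hS.trans hS₁
  obtain ⟨⟨hvloc, hvX⟩, hfloc, hcap⟩ := hsol
  set C := initialValue v with hCdef
  have hC : HasInitialValue v C := hasInitialValue_initialValue hvX
  have hvi : Integrable (cut S₂ v) := integrable_cut (integrableOn_Icc_of_timeInterval hvloc hS₂T)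
  have hvS : IntegrableOn v (Icc 0 S) := integrableOn_Icc_of_timeInterval hvloc hST
  set x : ℕ → ℝ → F := fun k => mollify η (ε k) (cut S₂ v) with hx
  have hxs : ∀ k, ContDiff ℝ ∞ (x k) := fun k => hη.contDiff_mollify (hε k) hvi
  have hxd : ∀ k, Differentiable ℝ (x k) := fun k => (hxs k).differentiable (by simp)
  have hxi : ∀ k, Integrable (x k) := fun k => integrable_conv (hη.integrable_scaled (hε k)) hvi
  have hx0 : Tendsto (fun k => x k 0) atTop (𝓝 C) :=
    hη.tendsto_mollify_zero hε hε₀ hvi (hasInitialValue_congr (hS₁0.trans hS₂)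
      (fun t ht => (cut_of_mem v (Ioo_subset_Icc_self ht)).symm) hC)
  have hxL : Tendsto (fun k => ∫ t, ‖x k t - cut S₂ v t‖) atTop (𝓝 0) :=
    hη.tendsto_integral_norm_mollify_sub hε hε₀ hvi
  have hxeq : ∀ᶠ k in atTop, ∀ t ∈ Icc 0 S₁, mollify η (ε k) v t = x k t := by
    obtain ⟨M, hM0, hM⟩ := hη.exists_support_bound
    have h1 : Tendsto (fun k => ε k * M) atTop (𝓝 0) := by simpa using hε₀.mul_const M
    filter_upwards [h1.eventually_lt_const (sub_pos.2 hS₂)] with k hk t ht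
    exact IsMollifier.mollify_congr hM (hε k) fun s hs =>
      (cut_of_mem v ⟨ht.1.trans hs.1, by linarith [hs.2, ht.2]⟩).symm
  obtain ⟨w, hw, hconvv⟩ := hconvv
  obtain ⟨fv, hfv, hfvL⟩ := hconvv S₁ hS₁0 hS₁T
  obtain ⟨W, hW, hconvE⟩ := hconvE
  obtain ⟨fE, hfE, hfEL⟩ := hconvE S₁ hS₁0 hS₁T
  have hwi := integrableOn_Icc_of_timeInterval hw hS₁T
  have hWi := integrableOn_Icc_of_timeInterval hW hS₁T
  have hsub : Icc 0 S ⊆ Icc 0 S₁ := Icc_subset_Icc_right hS₁.le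
  have hfvi : ∀ᶠ k in atTop, Integrable (cut S (fv k)) := by
    filter_upwards [hfv] with k hk using integrable_cut (hk.2.1.mono_set hsub)
  have hfEi : ∀ᶠ k in atTop, Integrable (cut S (fE k)) := by
    filter_upwards [hfE] with k hk using integrable_cut (hk.2.1.mono_set hsub)
  have hcw : Integrable (cut S w) := integrable_cut (hwi.mono_set hsub)
  have hcW : Integrable (cut S W) := integrable_cut (hWi.mono_set hsub)
  have hfvc : Tendsto (fun k => ∫ t, ‖cut S (fv k) t - cut S w t‖) atTop (𝓝 0) := by
    refine squeeze_zero' (Eventually.of_forall fun _ => integral_nonneg fun _ => norm_nonneg _)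
      ?_ hfvL
    filter_upwards [hfv] with k hk using integral_norm_cut_sub_le hS.le hS₁.le hk.2.1 hwi
  have hfEc : Tendsto (fun k => ∫ t, ‖cut S (fE k) t - cut S W t‖) atTop (𝓝 0) := by
    refine squeeze_zero' (Eventually.of_forall fun _ => integral_nonneg fun _ => norm_nonneg _)
      ?_ hfEL
    filter_upwards [hfE] with k hk using integral_norm_cut_sub_le hS.le hS₁.le hk.2.1 hWi
  have hidv : ∀ᶠ k in atTop, ∀ᵐ t, t < S →
      conv (kernel (1 - γ)) (cut S fun s => x k s - x k 0) t
        = conv (kernel 1) (cut S (fv k)) t := by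
    filter_upwards [hfv, hxeq] with k hk hke
    exact caputo_integrated_of_continuous hγ₁ hS hS₁ hk.1 hk.2.1 hk.2.2 (hxs k).continuous hke
  have hidE : ∀ᶠ k in atTop, ∀ᵐ t, t < S →
      conv (kernel (1 - γ)) (cut S fun s => E (x k s) - E (x k 0)) t
        = conv (kernel 1) (cut S (fE k)) t := by
    filter_upwards [hfE, hxeq] with k hk hke
    exact caputo_integrated_of_continuous (y := fun s => E (x k s)) hγ₁ hS hS₁ hk.1 hk.2.1 hk.2.2
      (hE.continuous.comp (hxs k).continuous) fun t ht => by rw [hke t ht]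
  have hγ' : 0 < 1 - γ := by linarith
  -- Identification of the limit of D_c^γ v^ε: the integrated equation passes to the limit in L¹,
  -- and comparison with that of v lets g_1 * be cancelled.
  have hwv : ∀ᵐ t, t < S → cut S w t = cut S (fun s => f (v s)) t := by
    have hfvi' : Integrable (cut S fun s => f (v s)) :=
      integrable_cut (integrableOn_Icc_of_timeInterval hfloc hST)
    refine ae_eq_of_conv_kernel_one hcw hfvi' (fun s hs => cut_of_neg _ hs)
      (fun s hs => cut_of_neg _ hs) ?_
    have hconst : ∀ c : F, IntegrableOn (fun _ : ℝ => c) (Icc 0 S) := fun c =>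
      integrableOn_const (by simp)
    have hxc : ∀ k, Integrable (cut S fun s => x k s - x k 0) := fun k =>
      integrable_cut ((hxi k).integrableOn.sub (hconst _))
    have hvc : Integrable (cut S fun s => v s - C) := integrable_cut (hvS.sub (hconst C))
    have hL : Tendsto (fun k => ∫ t, ‖cut S (fun s => x k s - x k 0) t
        - cut S (fun s => v s - C) t‖) atTop (𝓝 0) := by
      have h1 : Tendsto (fun k => (∫ t, ‖x k t - cut S₂ v t‖) + S * ‖x k 0 - C‖) atTop (𝓝 0) := by
        have h2 := hxL.add ((tendsto_iff_norm_sub_tendsto_zero.1 hx0).const_mul S)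
        simpa using h2
      refine squeeze_zero (fun _ => integral_nonneg fun _ => norm_nonneg _) (fun k => ?_) h1
      have h2 : ∫ t, (Icc 0 S).indicator (fun _ => ‖x k 0 - C‖) t = S * ‖x k 0 - C‖ := by
        rw [integral_indicator measurableSet_Icc, setIntegral_const, Measure.real,
          Real.volume_Icc, sub_zero, ENNReal.toReal_ofReal hS.le, smul_eq_mul]
      have h3 : Integrable ((Icc 0 S).indicator fun _ : ℝ => ‖x k 0 - C‖) :=
        (integrable_indicator_iff measurableSet_Icc).2 (integrableOn_const (by simp))
      have h4 := integral_add ((hxi k).sub hvi).norm h3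
      simp only [Pi.sub_apply] at h4
      rw [← h2, ← h4]
      refine integral_mono_of_nonneg (Eventually.of_forall fun _ => norm_nonneg _)
        (((hxi k).sub hvi).norm.add h3) (Eventually.of_forall fun t => ?_)
      by_cases ht : t ∈ Icc 0 S
      · simp only [cut_of_mem _ ht, indicator_of_mem ht,
          cut_of_mem v (Icc_subset_Icc_right (hS₁.trans hS₂).le ht)]
        rw [sub_sub_sub_comm]
        exact norm_sub_le _ _
      · simp [cut, indicator_of_notMem ht]
    have hb := integrable_cut_kernel hγ' S
    have hu := integrable_cut_kernel one_pos S
    have h1 : ∀ᵐ t, t < S → conv (cut S (kernel (1 - γ))) (cut S fun s => v s - C) t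
        = conv (cut S (kernel 1)) (cut S w) t := by
      refine ae_eq_of_tendsto_integral
        (Eventually.of_forall fun k => integrable_conv hb (hxc k)) (integrable_conv hb hvc)
        (hfvi.mono fun k hk => integrable_conv hu hk) (integrable_conv hu hcw)
        (tendsto_integral_norm_conv_sub hb (Eventually.of_forall hxc) hvc hL)
        (tendsto_integral_norm_conv_sub hu hfvi hcw hfvc) ?_
      filter_upwards [hidv] with k hk
      filter_upwards [hk] with t ht htS
      rw [conv_cut_kernel (fun s hs => cut_of_neg _ hs) htS.le,
        conv_cut_kernel (fun s hs => cut_of_neg _ hs) htS.le, ht htS]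
    filter_upwards [h1, caputo_integrated hγ₁ hvloc hfloc hcap hS hST] with t e1 e2 htS
    rw [← e2 htS, ← conv_cut_kernel (fun s hs => cut_of_neg _ hs) htS.le, ← e1 htS,
      conv_cut_kernel (fun s hs => cut_of_neg _ hs) htS.le]
  have hle : ∀ᶠ k in atTop, ∀ᵐ t, t ∈ Ioo 0 S → fE k t ≤ fderiv ℝ E (x k t) (fv k t) := by
    filter_upwards [hfv, hfE, hidv, hidE] with k h1 h2 h3 h4
    exact caputo_convex_le hγ' (by linarith) hconv (hE.differentiable (by simp)) (hxd k)
      (h1.2.1.mono_set hsub) (h2.2.1.mono_set hsub) h3 h4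
  have hrep : ∀ᶠ k in atTop, ∀ᵐ t, t ∈ Ioo 0 S →
      E (x k t) - E (x k 0) = conv (cut S (kernel γ)) (cut S (fE k)) t := by
    filter_upwards [hfEi, hidE] with k h1 h2
    have hc : Continuous fun s => E (x k s) - E (x k 0) :=
      (hE.continuous.comp (hxs k).continuous).sub continuous_const
    filter_upwards [ae_eq_conv_kernel hγ₀ hγ₁
      (integrable_cut (hc.continuousOn.integrableOn_compact isCompact_Icc)) h1
      (fun s hs => cut_of_neg _ hs) (fun s hs => cut_of_neg _ hs) h2] with t ht hts
    rw [conv_cut_kernel (fun s hs => cut_of_neg _ hs) hts.2.le, ← ht hts.2,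
      cut_of_mem _ (Ioo_subset_Icc_self hts)]
  have ha := integrable_cut_kernel hγ₀ S
  -- Nested subsequences give simultaneous almost-everywhere convergence of v^ε, of both Caputo
  -- derivatives, and of g_γ * D_c^γ E(v^ε).
  obtain ⟨n₁, hn₁, h1⟩ := exists_seq_tendsto_ae_of_integral (Eventually.of_forall hxi) hvi hxL
  obtain ⟨n₂, hn₂, h2⟩ := exists_seq_tendsto_ae_of_integral
    (hn₁.tendsto_atTop.eventually hfvi) hcw (hfvc.comp hn₁.tendsto_atTop)
  have hn₁₂ := hn₁.tendsto_atTop.comp hn₂.tendsto_atTop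
  obtain ⟨n₃, hn₃, h3⟩ := exists_seq_tendsto_ae_of_integral
    (hn₁₂.eventually hfEi) hcW (hfEc.comp hn₁₂)
  have hn₁₃ := hn₁₂.comp hn₃.tendsto_atTop
  obtain ⟨n₄, hn₄, h4⟩ := exists_seq_tendsto_ae_of_integral
    (hn₁₃.eventually (hfEi.mono fun k hk => integrable_conv ha hk)) (integrable_conv ha hcW)
    ((tendsto_integral_norm_conv_sub ha hfEi hcW hfEc).comp hn₁₃)
  have hn := hn₁₃.comp hn₄.tendsto_atTop
  set n : ℕ → ℕ := fun k => n₁ (n₂ (n₃ (n₄ k))) with hndef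
  replace hn : Tendsto n atTop atTop := hn
  obtain ⟨N, hN⟩ := eventually_atTop.1 (hn.eventually (hle.and hrep))
  have h5 : ∀ᵐ t, ∀ k ≥ N, t ∈ Ioo 0 S →
      fE (n k) t ≤ fderiv ℝ E (x (n k) t) (fv (n k) t) ∧
      E (x (n k) t) - E (x (n k) 0) = conv (cut S (kernel γ)) (cut S (fE (n k))) t := by
    refine ae_all_iff.2 fun k => ?_
    by_cases hk : N ≤ k
    · filter_upwards [(hN k hk).1, (hN k hk).2] with t e1 e2 _ ht using ⟨e1 ht, e2 ht⟩
    · exact Eventually.of_forall fun t hk' => absurd hk' hk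
  have hxt : ∀ᵐ t, t ∈ Ioo 0 S → Tendsto (fun k => x (n k) t) atTop (𝓝 (v t)) := by
    filter_upwards [h1] with t e1 ht
    rw [cut_of_mem v ⟨ht.1.le, by linarith [ht.2]⟩] at e1
    exact e1.comp (hn₂.tendsto_atTop.comp (hn₃.tendsto_atTop.comp hn₄.tendsto_atTop))
  -- The convexity inequality in the limit: W ≤ E'(v) f(v) ≤ 0, by continuity of E'.
  have hWneg : ∀ᵐ t, cut S W t ≤ 0 := by
    have hne0 : ∀ᵐ t : ℝ, t ≠ 0 := by simp [ae_iff]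
    have hneS : ∀ᵐ t : ℝ, t ≠ S := by simp [ae_iff]
    filter_upwards [hxt, h2, h3, h5, hwv, hne0, hneS] with t e1 e2 e3 e5 e6 ht0 htS
    by_cases ht : t ∈ Icc 0 S
    · have ht' : t ∈ Ioo 0 S := ⟨lt_of_le_of_ne ht.1 ht0.symm, lt_of_le_of_ne ht.2 htS⟩
      rw [e6 ht'.2] at e2
      simp only [Function.comp_apply, cut_of_mem _ ht] at e2 e3
      have e2' := e2.comp (hn₃.tendsto_atTop.comp hn₄.tendsto_atTop)
      have e3' := e3.comp hn₄.tendsto_atTop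
      have hlim : Tendsto (fun k => fderiv ℝ E (x (n k) t) (fv (n k) t)) atTop
          (𝓝 (fderiv ℝ E (v t) (f (v t)))) :=
        (isBoundedBilinearMap_apply.continuous.tendsto (fderiv ℝ E (v t), f (v t))).comp
          ((((hE.continuous_fderiv (by simp)).tendsto (v t)).comp (e1 ht')).prodMk_nhds e2')
      rw [cut_of_mem _ ht]
      refine (le_of_tendsto_of_tendsto e3' hlim ?_).trans (hf (v t))
      filter_upwards [eventually_ge_atTop N] with k hk using (e5 k hk ht').1
    · rw [cut, indicator_of_notMem ht]
  filter_upwards [hxt, h4, h5] with t e1 e4 e5 ht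
  -- Two limits of the same sequence give E(v(t)) - E(v(0+)) = (g_γ * W)(t).
  have l1 : Tendsto (fun k => E (x (n k) t) - E (x (n k) 0)) atTop (𝓝 (E (v t) - E C)) :=
    ((hE.continuous.tendsto _).comp (e1 ht)).sub
      ((hE.continuous.tendsto _).comp (hx0.comp hn))
  have l2 : Tendsto (fun k => E (x (n k) t) - E (x (n k) 0)) atTop
      (𝓝 (conv (cut S (kernel γ)) (cut S W) t)) := by
    refine Tendsto.congr' ?_ e4
    filter_upwards [eventually_ge_atTop N] with k hk using (e5 k hk ht).2.symm
  have l3 := tendsto_nhds_unique l1 l2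
  rw [conv_cut_kernel (fun s hs => cut_of_neg _ hs) ht.2.le] at l3
  have l4 := conv_kernel_nonpos hγ₀ hWneg t
  linarith

/-! ### Passage to [0, T) and the two types of equation -/

theorem measurableSet_timeInterval (T : EReal) : MeasurableSet (timeInterval T) :=
  measurableSet_Ici.inter (before T).isOpen.measurableSet

/-- Rational endpoints suffice, so only countably many null sets are discarded. -/
theorem ae_timeInterval_of_forall_lt {T : EReal} {P : ℝ → Prop}
    (h : ∀ S : ℝ, 0 < S → (S : EReal) < T → ∀ᵐ t, t ∈ Ioo 0 S → P t) :
    ∀ᵐ t, t ∈ timeInterval T → P t := by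
  have h1 : ∀ᵐ t : ℝ, ∀ q : ℚ, 0 < (q : ℝ) → ((q : ℝ) : EReal) < T →
      t ∈ Ioo 0 (q : ℝ) → P t := by
    refine ae_all_iff.2 fun q => ?_
    by_cases hq : 0 < (q : ℝ) ∧ ((q : ℝ) : EReal) < T
    · filter_upwards [h q hq.1 hq.2] with t ht _ _ using ht
    · exact Eventually.of_forall fun t h1 h2 => absurd ⟨h1, h2⟩ hq
  have hne : ∀ᵐ t : ℝ, t ≠ 0 := by simp [ae_iff]
  filter_upwards [h1, hne] with t ht ht0 htT
  obtain ⟨q, hq, hqT⟩ := EReal.lt_iff_exists_rat_btwn.1 htT.2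
  have hq' : t < (q : ℝ) := by exact_mod_cast hq
  have hpos : 0 < t := lt_of_le_of_ne htT.1 ht0.symm
  exact ht q (hpos.trans hq') hqT ⟨hpos, hq'⟩

theorem initialValue_of_continuousOn {T : EReal} (hT : 0 < T) {v : ℝ → G}
    (hv : ContinuousOn v (timeInterval T)) : initialValue v = v 0 := by
  obtain ⟨r, hr, hrT⟩ := EReal.lt_iff_exists_real_btwn.1 hT
  have hr0 : 0 < r := by exact_mod_cast hr
  have hc : ContinuousOn v (Icc 0 r) :=
    hv.mono fun t ht => ⟨ht.1, (EReal.coe_le_coe_iff.2 ht.2).trans_lt hrT⟩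
  have h1 : Continuous (IccExtend hr0.le ((Icc 0 r).domRestrict v)) :=
    (continuousOn_iff_continuous_domRestrict.1 hc).Icc_extend'
  have h2 : ∀ t ∈ Icc 0 r, IccExtend hr0.le ((Icc 0 r).domRestrict v) t = v t := fun t ht => by
    rw [IccExtend_of_mem _ _ ht]
    rfl
  refine initialValue_eq hr0 (hc.integrableOn_compact isCompact_Icc) ?_
  have h3 := hasInitialValue_congr hr0 (fun t ht => h2 t (Ioo_subset_Icc_self ht))
    (hasInitialValue_of_continuous h1)
  rwa [h2 0 ⟨le_rfl, hr0.le⟩] at h3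

/-- Every t, including t = 0, is approached from the right by points where the bound holds. -/
theorem forall_le_of_ae_le {T : EReal} {φ : ℝ → ℝ} {c : ℝ} (hφ : ContinuousOn φ (timeInterval T))
    (h : ∀ᵐ t, t ∈ timeInterval T → φ t ≤ c) : ∀ t ∈ timeInterval T, φ t ≤ c := by
  intro t ht
  obtain ⟨r, hr, hrT⟩ := EReal.lt_iff_exists_real_btwn.1 ht.2
  have hmem : timeInterval T ∈ 𝓝[>] t := by
    filter_upwards [Ioo_mem_nhdsGT (EReal.coe_lt_coe_iff.1 hr)] with s hs
    exact ⟨ht.1.trans hs.1.le, (EReal.coe_lt_coe_iff.2 hs.2).trans hrT⟩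
  refine le_of_tendsto_of_frequently ((hφ t ht).mono_left (nhdsWithin_le_of_mem hmem)) ?_
  exact ((frequently_nhdsGT_of_ae h t).and_eventually hmem).mono fun s hs => hs.1 hs.2

/-- E'(x) f(x) is -|∇E(x)|² in the first case and ⟨∇E(x), J ∇E(x)⟩ = 0 by skewness in the second. -/
theorem exists_isSolution_fderiv_nonpos {m : ℕ} {γ : ℝ} {E : EuclideanSpace ℝ (Fin m) → ℝ}
    {T : EReal} {v : ℝ → EuclideanSpace ℝ (Fin m)}
    (hsol : IsSolution γ T (fun x => -gradient E x) v ∨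
      ∃ J : EuclideanSpace ℝ (Fin m) →L[ℝ] EuclideanSpace ℝ (Fin m),
        ContinuousLinearMap.adjoint J = -J ∧ IsSolution γ T (fun x => J (gradient E x)) v) :
    ∃ f, IsSolution γ T f v ∧ ∀ x, fderiv ℝ E x (f x) ≤ 0 := by
  rcases hsol with h | ⟨J, hJ, h⟩
  · refine ⟨_, h, fun x => ?_⟩
    rw [← inner_gradient_left, inner_neg_right, neg_nonpos]
    exact real_inner_self_nonneg
  · refine ⟨_, h, fun x => ?_⟩
    rw [← inner_gradient_left]
    have h1 := ContinuousLinearMap.adjoint_inner_right J (gradient E x) (gradient E x)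
    rw [hJ, neg_apply, inner_neg_right, real_inner_comm (gradient E x)] at h1
    linarith

end FracODE

end

theorem mainTheorem12 {m : ℕ} {γ : ℝ} (hγ₀ : 0 < γ) (hγ₁ : γ < 1)
    (E : EuclideanSpace ℝ (Fin m) → ℝ) (hE : ContDiff ℝ 1 E) (hconv : ConvexOn ℝ univ E)
    (hLip : LocallyLipschitz (gradient E))
    (T : EReal) (hT : 0 < T) (v : ℝ → EuclideanSpace ℝ (Fin m))
    (hsol : FracODE.IsSolution γ T (fun x => -gradient E x) v ∨
      ∃ J : EuclideanSpace ℝ (Fin m) →L[ℝ] EuclideanSpace ℝ (Fin m),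
        ContinuousLinearMap.adjoint J = -J ∧
          FracODE.IsSolution γ T (fun x => J (gradient E x)) v)
    (hEv : FracODE.CaputoIsFunction γ T (fun t => E (v t)))
    (η : ℝ → ℝ) (hη : FracODE.IsMollifier η)
    (ε : ℕ → ℝ) (hε : ∀ k, 0 < ε k) (hε₀ : Tendsto ε atTop (𝓝 0))
    (hconvE : FracODE.CaputoConvergesL1loc γ T
      (fun k t => E (FracODE.mollify η (ε k) v t)))
    (hconvv : FracODE.CaputoConvergesL1loc γ T
      (fun k => FracODE.mollify η (ε k) v)) :
    (∀ᵐ t ∂(volume.restrict (FracODE.timeInterval T)),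
        E (v t) ≤ E (FracODE.initialValue v)) ∧
      (ContinuousOn v (FracODE.timeInterval T) →
        ∀ t ∈ FracODE.timeInterval T, E (v t) ≤ E (v 0)) := by
  obtain ⟨f, hsol, hf⟩ := FracODE.exists_isSolution_fderiv_nonpos hsol
  have hae : ∀ᵐ t, t ∈ FracODE.timeInterval T → E (v t) ≤ E (FracODE.initialValue v) :=
    FracODE.ae_timeInterval_of_forall_lt fun S hS hST =>
      FracODE.energy_le_of_lt hγ₀ hγ₁ hE hconv hsol hf hη hε hε₀ hconvE hconvv hS hST
  refine ⟨(ae_restrict_iff' (FracODE.measurableSet_timeInterval T)).2 hae, fun hv => ?_⟩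
  rw [FracODE.initialValue_of_continuousOn hT hv] at hae
  exact FracODE.forall_le_of_ae_le (hE.continuous.comp_continuousOn hv) hae
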